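/- Let $(V,E,i,t)$ be a finite directed multigraph ($i(e)$, $t(e)$ the initial and terminal vertex of the edge $e$) with $i:E\to V$ surjective. Let $(K,d)$ be a metric space in which sets of finite diameter are relatively compact, and let $(K_v)_{v\in V}$ be a partition of $K$ into non-empty open sets. For $e\in E$ let $w_e:K\to K$ be Borel measurable with $w_e(K_{i(e)})\subset K_{t(e)}$, and let $p_e:K\to[0,1]$ be Borel measurable, zero outside $K_{i(e)}$, with $\sum_{e\in E}p_e(x)=1$ for all $x\in K$. Assume that for some $0<a<1$ $$\sum_{e\in E}p_e(x)\,d(w_ex,w_ey)\le a\,d(x,y)\qquad\text{for all }v\in V,\ x,y\in K_v,$$ that each $p_e|_{K_{i(e)}}$ is uniformly continuous, and that for some $\delta>0$ one has $p_e|_{K_{i(e)}}\ge\delta$ for all $e\in E$. Put $Uf:=\sum_{e\in E}p_e\cdot f\circ w_e$ for bounded Borel $f$ and $U^*\nu(f):=\int Uf\,d\nu$ for Borel probability measures $\nu$ on $K$, and assume that there is a Borel probability measure $\mu$ on $K$ with $U^*\mu=\mu$. Let $\Sigma:=E^{\mathbb Z}$ with the product topology and the left shift $S$, fix $x_v\in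 K_v$ for all $v\in V$, and set $$F(\sigma):=\lim_{m\to-\infty}w_{\sigma_0}\circ w_{\sigma_{-1}}\circ\dots\circ w_{\sigma_m}x_{i(\sigma_m)}$$ whenever the limit exists. Let $\Sigma_G:=\{\sigma\in\Sigma: t(\sigma_j)=i(\sigma_{j+1})\ \forall j\in\mathbb Z\}$, let $D$ be the set of all $\sigma\in\Sigma_G$ for which this limit exists, and let $Y:=\bigcap_{j\in\mathbb Z}S^j(D)$. Define $u:\Sigma\to[-\infty,0]$ by $u(\sigma):=\log p_{\sigma_1}(F(\sigma))$ for $\sigma\in Y$ and $u(\sigma):=-\infty$ for $\sigma\in\Sigma\setminus Y$. Let $P_S(\Sigma)$ be the set of $S$-invariant Borel probability measures on $\Sigma$ and $h_\Theta(S)$ the Kolmogorov–Sinai entropy of $S$ with respect to $\Theta$. If $\Lambda\in P_S(\Sigma)$ is an equilibrium state for $u$, i.e. $h_\Lambda(S)+\int u\,d\Lambda=\sup_{\Theta\in P_S(\Sigma)}\bigl(h_\Theta(S)+\int u\,d\Theta\bigr)$, then $\Lambda(Y)=1$ (so that $F$ is defined $\Lambda$-a.e.), $F$ is $\Lambda$-measurable,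 and its image measure $F(\Lambda)$ satisfies $$U^*F(\Lambda)=F(\Lambda).$$ -/

import Mathlib

open MeasureTheory Filter Topology Set

noncomputable section

/-! ### Kolmogorov-Sinai entropy, pressure, equilibrium states -/

/-- Shannon entropy (natural logarithm) of the finite partition of `X` into the fibres of a map
`ξ` with values in a finite type. -/
def partitionEntropy {X : Type*} [MeasurableSpace X] (μ : Measure X)
    {ι : Type*} [Fintype ι] (ξ : X → ι) : ℝ :=
  ∑ c : ι, Real.negMulLog (μ.real (ξ ⁻¹' {c}))

/-- The label map of the joined partition `⋁_{j < n} T⁻ʲ ξ`. -/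
def itinerary {X ι : Type*} (T : X → X) (ξ : X → ι) (n : ℕ) : X → (Fin n → ι) :=
  fun x j => ξ (T^[(j : ℕ)] x)

/-- The entropy `h_μ(T, ξ) = lim (1/n) H(⋁_{j < n} T⁻ʲ ξ)` of `T` with respect to a finite
partition.  For an invariant probability measure the limit exists, so the upper limit is the
limit. -/
def entropyOfPartition {X : Type*} [MeasurableSpace X] (T : X → X) (μ : Measure X)
    {ι : Type*} [Fintype ι] (ξ : X → ι) : EReal :=
  limsup (fun n : ℕ => ((partitionEntropy μ (itinerary T ξ n) / (n : ℝ) : ℝ) : EReal)) atTop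

/-- The Kolmogorov-Sinai entropy `h_μ(T)`: the supremum over all finite measurable partitions. -/
def ksEntropy {X : Type*} [MeasurableSpace X] (T : X → X) (μ : Measure X) : EReal :=
  ⨆ (k : ℕ) (ξ : X → Fin k) (_ : Measurable ξ), entropyOfPartition T μ ξ

/-- The set `P_T(X)` of `T`-invariant probability measures. -/
def invariantProb {X : Type*} [MeasurableSpace X] (T : X → X) : Set (Measure X) :=
  {μ | IsProbabilityMeasure μ ∧ MeasurePreserving T μ μ}

/-- The integral `μ(f) ∈ [-∞, 0]` of an energy function `f : X → [-∞, 0]`. -/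
def energyIntegral {X : Type*} [MeasurableSpace X] (μ : Measure X) (f : X → EReal) : EReal :=
  -((∫⁻ x, (-(f x)).toENNReal ∂μ : ENNReal) : EReal)

/-- The pressure of an energy function. -/
def pressure {X : Type*} [MeasurableSpace X] (T : X → X) (f : X → EReal) : EReal :=
  ⨆ μ ∈ invariantProb T, (ksEntropy T μ + energyIntegral μ f)

/-- Equilibrium states of an energy function. -/
def IsEquilibriumState {X : Type*} [MeasurableSpace X] (T : X → X) (f : X → EReal)
    (μ : Measure X) : Prop :=
  μ ∈ invariantProb T ∧ ksEntropy T μ + energyIntegral μ f = pressure T f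

/-! ### The code space -/

/-- The left shift on the code space `ℤ → E`. The code space carries the product σ-algebra,
which for a finite discrete `E` is the Borel σ-algebra of the product topology. -/
def codeShift (E : Type*) : Equiv.Perm (ℤ → E) where
  toFun σ := fun k => σ (k + 1)
  invFun σ := fun k => σ (k - 1)
  left_inv σ := by funext k; simp
  right_inv σ := by funext k; simp

/-! ### Markov systems -/

/-- A Markov system `(K_{i(e)}, w_e, p_e)_{e ∈ E}` on `K`, over the finite directed multigraph
with vertices `V`, edges `E`, initial vertices `ini` and terminal vertices `ter`. -/
structure MarkovSystem (V E K : Type*) [Fintype E] [MeasurableSpace K] where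
  ini : E → V
  ter : E → V
  vertexSet : V → Set K
  w : E → K → K
  p : E → K → ℝ
  vertexSet_measurable : ∀ v, MeasurableSet (vertexSet v)
  vertexSet_nonempty : ∀ v, (vertexSet v).Nonempty
  vertexSet_disjoint : ∀ v v', v ≠ v' → Disjoint (vertexSet v) (vertexSet v')
  vertexSet_cover : (⋃ v, vertexSet v) = univ
  w_measurable : ∀ e, Measurable (w e)
  w_mapsTo : ∀ e, MapsTo (w e) (vertexSet (ini e)) (vertexSet (ter e))
  p_measurable : ∀ e, Measurable (p e)
  p_nonneg : ∀ e x, 0 ≤ p e x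
  p_sum : ∀ x, ∑ e, p e x = 1
  p_zero : ∀ e x, x ∉ vertexSet (ini e) → p e x = 0

namespace MarkovSystem

variable {V E K : Type*} [Fintype E] [MeasurableSpace K]

/-- Contractiveness on average, with average contracting rate `a`. -/
def IsContractive [PseudoMetricSpace K] (𝓜 : MarkovSystem V E K) (a : ℝ) : Prop :=
  0 < a ∧ a < 1 ∧ ∀ v, ∀ x ∈ 𝓜.vertexSet v, ∀ y ∈ 𝓜.vertexSet v,
    ∑ e, 𝓜.p e x * dist (𝓜.w e x) (𝓜.w e y) ≤ a * dist x y

/-- The Markov operator `U f = ∑ e, p_e · (f ∘ w_e)`. -/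
def markovOp (𝓜 : MarkovSystem V E K) (f : K → ℝ) : K → ℝ :=
  fun x => ∑ e, 𝓜.p e x * f (𝓜.w e x)

/-- The adjoint operator `U*` on measures; see `integral_adjointOp` below. -/
def adjointOp (𝓜 : MarkovSystem V E K) (ν : Measure K) : Measure K :=
  ∑ e, (ν.withDensity (fun x => ENNReal.ofReal (𝓜.p e x))).map (𝓜.w e)

/-- `adjointOp` is the adjoint of the Markov operator: `U*ν(f) = ∫ U f dν` for bounded Borel
functions `f`. -/
theorem integral_adjointOp (𝓜 : MarkovSystem V E K) (ν : Measure K) [IsProbabilityMeasure ν]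
    (f : K → ℝ) (hf : Measurable f) (C : ℝ) (hC : ∀ x, |f x| ≤ C) :
    ∫ x, f x ∂(𝓜.adjointOp ν) = ∫ x, 𝓜.markovOp f x ∂ν := by
  have hp1 : ∀ e x, 𝓜.p e x ≤ 1 := fun e x => by
    rw [← 𝓜.p_sum x]
    exact Finset.single_le_sum (fun e _ => 𝓜.p_nonneg e x) (Finset.mem_univ e)
  have hm : ∀ e, Measurable fun x => Real.toNNReal (𝓜.p e x) :=
    fun e => (𝓜.p_measurable e).real_toNNReal
  have hfin : ∀ e, IsFiniteMeasure (ν.withDensity (fun x => ENNReal.ofReal (𝓜.p e x))) := by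
    intro e
    refine isFiniteMeasure_withDensity (ne_of_lt ?_)
    calc ∫⁻ x, ENNReal.ofReal (𝓜.p e x) ∂ν ≤ ∫⁻ _, 1 ∂ν :=
          lintegral_mono fun x => by simpa using hp1 e x
      _ < ⊤ := by simp
  have hint : ∀ e, Integrable f
      ((ν.withDensity (fun x => ENNReal.ofReal (𝓜.p e x))).map (𝓜.w e)) := by
    intro e
    have := hfin e
    exact Integrable.of_bound hf.aestronglyMeasurable C (ae_of_all _ hC)
  have hint2 : ∀ e, Integrable (fun x => 𝓜.p e x * f (𝓜.w e x)) ν := by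
    intro e
    refine Integrable.of_bound
      ((𝓜.p_measurable e).mul (hf.comp (𝓜.w_measurable e))).aestronglyMeasurable C
      (ae_of_all _ fun x => ?_)
    rw [norm_mul, Real.norm_of_nonneg (𝓜.p_nonneg e x), Real.norm_eq_abs]
    exact (mul_le_of_le_one_left (abs_nonneg _) (hp1 e x)).trans (hC _)
  unfold adjointOp markovOp
  rw [integral_finsetSum_measure (fun e _ => hint e), integral_finsetSum _ (fun e _ => hint2 e)]
  refine Finset.sum_congr rfl fun e _ => ?_
  rw [integral_map (𝓜.w_measurable e).aemeasurable hf.aestronglyMeasurable]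
  have := integral_withDensity_eq_integral_smul (μ := ν) (hm e) (fun x => f (𝓜.w e x))
  refine Eq.trans this (integral_congr_ae (ae_of_all _ fun x => ?_))
  simp [NNReal.smul_def, Real.coe_toNNReal _ (𝓜.p_nonneg e x)]

/-- The composition `w_{σ_0} ∘ w_{σ_{-1}} ∘ ⋯ ∘ w_{σ_{-n}}`. -/
def backComp (𝓜 : MarkovSystem V E K) (σ : ℤ → E) : ℕ → K → K
  | 0 => 𝓜.w (σ 0)
  | n + 1 => 𝓜.backComp σ n ∘ 𝓜.w (σ (-((n : ℤ) + 1)))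

/-- The approximant `w_{σ_0} ∘ ⋯ ∘ w_{σ_{-n}} x_{i(σ_{-n})}` of the coding map. -/
def codingApprox (𝓜 : MarkovSystem V E K) (x : V → K) (σ : ℤ → E) (n : ℕ) : K :=
  𝓜.backComp σ n (x (𝓜.ini (σ (-(n : ℤ)))))

/-- The set `Σ_G` of two-sided infinite paths of the graph. -/
def pathSpace (𝓜 : MarkovSystem V E K) : Set (ℤ → E) :=
  {σ | ∀ j : ℤ, 𝓜.ter (σ j) = 𝓜.ini (σ (j + 1))}

/-- The set `D` of paths for which the limit defining the coding map exists. -/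
def codingDomain [TopologicalSpace K] (𝓜 : MarkovSystem V E K) (x : V → K) : Set (ℤ → E) :=
  {σ | σ ∈ 𝓜.pathSpace ∧ ∃ z, Tendsto (𝓜.codingApprox x σ) atTop (𝓝 z)}

/-- The set `Y = ⋂_{j ∈ ℤ} S^j(D)`. -/
def codingCore [TopologicalSpace K] (𝓜 : MarkovSystem V E K) (x : V → K) : Set (ℤ → E) :=
  ⋂ j : ℤ, (codeShift E ^ j : Equiv.Perm (ℤ → E)) '' 𝓜.codingDomain x

open Classical in
/-- The coding map `F`, the limit of the approximants where it exists (and an irrelevant value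
elsewhere). -/
def codingMap [TopologicalSpace K] (𝓜 : MarkovSystem V E K) (x : V → K) (σ : ℤ → E) : K :=
  if h : ∃ z, Tendsto (𝓜.codingApprox x σ) atTop (𝓝 z) then h.choose else x (𝓜.ini (σ 0))

open Classical in
/-- The energy function `u`: `log p_{σ_1}(F(σ))` on `Y` and `-∞` off `Y`. -/
def energy [TopologicalSpace K] (𝓜 : MarkovSystem V E K) (x : V → K) (σ : ℤ → E) : EReal :=
  if σ ∈ 𝓜.codingCore x then
    ENNReal.log (ENNReal.ofReal (𝓜.p (σ 1) (𝓜.codingMap x σ)))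
  else ⊥

end MarkovSystem

end

/-! ### Shannon entropy of finite-valued random variables -/

section Shannon

/-! The argument is variational. If q assigns to finitely many past letters a subprobability vector
for the next letter, Gibbs' inequality applied letter by letter bounds the entropy of the shift by
the expected loss, h_Λ(S) ≤ ∫ -log q(σ)(σ_1) dΛ (`ksEntropy_codeShift_le`). Predicting with p_e at
the approximants of F and passing to the limit shows that the free energy h_Λ(S) + ∫ u dΛ is at most
0 whenever Λ(Y) = 1.

In the other direction, let M be the law of the stationary edge process with initial distribution μ
(`exists_markovMeasure`). By concavity of -t log t its entropy is at least ∫ H dμ, where H(y) is the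
entropy of the vector (p_e(y)). By contraction on average, F exists M-almost everywhere and the
expected loss -∫ u dM is at most ∫ H dμ. So the pressure is at least 0 (`pressure_energy_nonneg`).
An equilibrium state Λ therefore has ∫ u dΛ > -∞, which forces Λ(Y) = 1, and p_{σ_1}(F(σ)) attains
the minimal loss.

Minimality is used through a first variation. For bounded continuous f the increment θ_e = f ∘ w_e -
Uf has mean zero under (p_e), so p_e (1 + tθ_e) is again a predictor for small t. It cannot beat the
entropy, hence ∫ log(1 + tθ) dΛ ≤ 0 for small t of either sign, and so ∫ θ dΛ = 0
(`integral_increment_eq_zero`). On Y one has w_{σ_1}(F(σ)) = F(Sσ), so the shift invariance of Λ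
turns this into ∫ f dF(Λ) = ∫ Uf dF(Λ). -/

theorem ae_measureReal_fiber_pos {X : Type*} [MeasurableSpace X] {μ : Measure X}
    [IsProbabilityMeasure μ] {ι : Type*} [Fintype ι] {Z : X → ι} :
    ∀ᵐ x ∂μ, 0 < μ.real (Z ⁻¹' {Z x}) := by
  have : ∀ᵐ x ∂μ, ∀ c, Z x = c → 0 < μ.real (Z ⁻¹' {c}) := by
    rw [ae_all_iff]
    intro c
    by_cases h : μ.real (Z ⁻¹' {c}) = 0
    · rw [measureReal_eq_zero_iff] at h
      filter_upwards [measure_eq_zero_iff_ae_notMem.1 h] with x hx hc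
      exact absurd hc hx
    · exact ae_of_all _ fun x _ => lt_of_le_of_ne measureReal_nonneg (Ne.symm h)
  filter_upwards [this] with x hx using hx _ rfl

variable {X : Type*} [MeasurableSpace X] {μ : Measure X} [IsProbabilityMeasure μ]
  {ι κ : Type*} [Fintype ι] [Fintype κ] [MeasurableSpace ι] [MeasurableSpace κ]
  [MeasurableSingletonClass ι] [MeasurableSingletonClass κ]

theorem measurable_of_comp_finite {Y : Type*} [MeasurableSpace Y] {Z : X → ι} (hZ : Measurable Z)
    (φ : ι → Y) : Measurable fun x => φ (Z x) :=
  (measurable_of_finite φ).comp hZ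

theorem integrable_comp_finite {Z : X → ι} (hZ : Measurable Z) (φ : ι → ℝ) :
    Integrable (fun x => φ (Z x)) μ := by
  refine Integrable.of_bound (measurable_of_comp_finite hZ φ).aestronglyMeasurable
    (∑ c, ‖φ c‖) (ae_of_all _ fun x => ?_)
  exact Finset.single_le_sum (f := fun c => ‖φ c‖) (fun _ _ => norm_nonneg _)
    (Finset.mem_univ (Z x))

theorem integral_comp_finite {Z : X → ι} (hZ : Measurable Z) (φ : ι → ℝ) :
    ∫ x, φ (Z x) ∂μ = ∑ c, μ.real (Z ⁻¹' {c}) * φ c := by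
  have : IsProbabilityMeasure (μ.map Z) := Measure.isProbabilityMeasure_map hZ.aemeasurable
  rw [← integral_map (f := φ) hZ.aemeasurable (measurable_of_finite φ).aestronglyMeasurable,
    integral_fintype Integrable.of_finite]
  refine Finset.sum_congr rfl fun c _ => ?_
  rw [map_measureReal_apply hZ (measurableSet_singleton c), smul_eq_mul]

theorem partitionEntropy_eq_integral {Z : X → ι} (hZ : Measurable Z) :
    partitionEntropy μ Z = ∫ x, -Real.log (μ.real (Z ⁻¹' {Z x})) ∂μ := by
  rw [integral_comp_finite hZ (fun c => -Real.log (μ.real (Z ⁻¹' {c})))]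
  simp [partitionEntropy, Real.negMulLog]

/-- The entropy of a function of a random variable is at most that of the variable. -/
theorem partitionEntropy_le_of_factor {Z : X → ι} (hZ : Measurable Z) {W : X → κ} (g : ι → κ)
    (hg : ∀ x, W x = g (Z x)) : partitionEntropy μ W ≤ partitionEntropy μ Z := by
  have hW : Measurable W := by
    rw [funext hg]; exact measurable_of_comp_finite hZ g
  rw [partitionEntropy_eq_integral hZ, partitionEntropy_eq_integral hW]
  refine integral_mono_ae (integrable_comp_finite hW fun c => -Real.log (μ.real (W ⁻¹' {c})))
    (integrable_comp_finite hZ fun c => -Real.log (μ.real (Z ⁻¹' {c}))) ?_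
  filter_upwards [ae_measureReal_fiber_pos (μ := μ) (Z := Z)] with x hx
  refine neg_le_neg (Real.log_le_log hx (measureReal_mono ?_))
  intro y hy
  simp only [mem_preimage, mem_singleton_iff] at hy ⊢
  rw [hg, hg, hy]

/-- Gibbs' inequality for a conditional distribution: if `r z` is a subprobability vector for each
`z`, then `H(Z, W) ≤ H(Z) + E[-log r(Z, W)]`. -/
theorem partitionEntropy_prod_le {Z : X → ι} (hZ : Measurable Z) {W : X → κ} (hW : Measurable W)
    (r : ι → κ → ℝ) (hr0 : ∀ z k, 0 ≤ r z k) (hr1 : ∀ z, ∑ k, r z k ≤ 1)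
    (hpos : ∀ᵐ x ∂μ, 0 < r (Z x) (W x)) :
    partitionEntropy μ (fun x => (Z x, W x)) ≤
      partitionEntropy μ Z + ∫ x, -Real.log (r (Z x) (W x)) ∂μ := by
  have hZW : Measurable fun x => (Z x, W x) := hZ.prodMk hW
  set P : ι × κ → ℝ := fun c => μ.real ((fun x => (Z x, W x)) ⁻¹' {c}) with hP
  set Q : ι → ℝ := fun c => μ.real (Z ⁻¹' {c}) with hQ
  have hi1 : Integrable (fun x => -Real.log (Q (Z x))) μ :=
    integrable_comp_finite hZ fun c => -Real.log (Q c)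
  have hi2 : Integrable (fun x => -Real.log (r (Z x) (W x))) μ :=
    integrable_comp_finite hZW fun c => -Real.log (r c.1 c.2)
  have hi3 : Integrable (fun x => -Real.log (P (Z x, W x))) μ :=
    integrable_comp_finite hZW fun c => -Real.log (P c)
  have hi4 : Integrable (fun x => r (Z x) (W x) * Q (Z x) / P (Z x, W x)) μ :=
    integrable_comp_finite hZW fun c => r c.1 c.2 * Q c.1 / P c
  rw [partitionEntropy_eq_integral hZ, partitionEntropy_eq_integral hZW, ← sub_nonpos,
    ← integral_add hi1 hi2]
  have hi5 : Integrable
      (fun x => -Real.log (Q (Z x)) + -Real.log (r (Z x) (W x))) μ := hi1.add hi2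
  change (∫ x, -Real.log (P (Z x, W x)) ∂μ) - _ ≤ 0
  rw [← integral_sub hi3 hi5]
  -- This is the expected likelihood ratio of the model r·Q against the true law P. Cells with P c =
  -- 0 drop out, which only decreases the sum. Combined with log s ≤ s - 1 it gives the claim.
  have hle : ∫ x, r (Z x) (W x) * Q (Z x) / P (Z x, W x) ∂μ ≤ 1 := by
    rw [integral_comp_finite hZW fun c => r c.1 c.2 * Q c.1 / P c]
    calc ∑ c, P c * (r c.1 c.2 * Q c.1 / P c) ≤ ∑ c : ι × κ, r c.1 c.2 * Q c.1 := by
          refine Finset.sum_le_sum fun c _ => ?_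
          by_cases h : P c = 0
          · simp only [h, zero_mul]
            exact mul_nonneg (hr0 _ _) measureReal_nonneg
          · rw [mul_div_cancel₀ _ h]
      _ = ∑ z, (∑ k, r z k) * Q z := by
          rw [Fintype.sum_prod_type]
          simp_rw [Finset.sum_mul]
      _ ≤ ∑ z, Q z * 1 := by
          refine Finset.sum_le_sum fun z _ => ?_
          rw [mul_comm]
          exact mul_le_mul_of_nonneg_left (hr1 z) measureReal_nonneg
      _ = 1 := by
          rw [← integral_comp_finite hZ fun _ => (1 : ℝ)]
          simp
  calc _ ≤ ∫ x, (r (Z x) (W x) * Q (Z x) / P (Z x, W x) - 1) ∂μ := by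
        refine integral_mono_ae (hi3.sub hi5) (hi4.sub (integrable_const _)) ?_
        filter_upwards [ae_measureReal_fiber_pos (μ := μ) (Z := Z),
          ae_measureReal_fiber_pos (μ := μ) (Z := fun x => (Z x, W x)), hpos] with x h1 h2 h3
        have h1' : 0 < Q (Z x) := h1
        have h2' : 0 < P (Z x, W x) := h2
        have := Real.log_le_sub_one_of_pos (div_pos (mul_pos h3 h1') h2')
        rw [Real.log_div (mul_pos h3 h1').ne' h2'.ne', Real.log_mul h3.ne' h1'.ne'] at this
        linarith
    _ = (∫ x, r (Z x) (W x) * Q (Z x) / P (Z x, W x) ∂μ) - 1 := by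
        rw [integral_sub hi4 (integrable_const _)]; simp
    _ ≤ 0 := by linarith

/-- Variant for a kernel given on points rather than on values of Z. `Function.extend` descends it
to the values, with the zero vector, still a subprobability, off the range of Z. -/
theorem partitionEntropy_prod_le' {Z : X → ι} (hZ : Measurable Z) {W : X → κ} (hW : Measurable W)
    (r : X → κ → ℝ) (hr : ∀ x y, Z x = Z y → r x = r y) (hr0 : ∀ x k, 0 ≤ r x k)
    (hr1 : ∀ x, ∑ k, r x k ≤ 1) (hpos : ∀ᵐ x ∂μ, 0 < r x (W x)) :
    partitionEntropy μ (fun x => (Z x, W x)) ≤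
      partitionEntropy μ Z + ∫ x, -Real.log (r x (W x)) ∂μ := by
  have hf : Function.FactorsThrough r Z := fun x y h => hr x y h
  have key : ∀ x, Function.extend Z r 0 (Z x) = r x := fun x => hf.extend_apply 0 x
  have h := partitionEntropy_prod_le (μ := μ) hZ hW (Function.extend Z r 0) ?_ ?_ ?_
  · simpa only [key] using h
  · intro z k
    by_cases hz : ∃ x, Z x = z
    · obtain ⟨x, rfl⟩ := hz
      rw [key]; exact hr0 x k
    · rw [Function.extend_apply' _ _ _ hz]; simp
  · intro z
    by_cases hz : ∃ x, Z x = z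
    · obtain ⟨x, rfl⟩ := hz
      rw [key]; exact hr1 x
    · rw [Function.extend_apply' _ _ _ hz]; simp
  · simpa only [key] using hpos

end Shannon

/-! ### Windows of two-sided sequences and an entropy bound for the shift -/

/-- The block `σ_j, …, σ_{j+n-1}` of a two-sided sequence. -/
def window {E : Type*} (j : ℤ) (n : ℕ) (σ : ℤ → E) : Fin n → E := fun i => σ (j + (i : ℕ))

theorem window_eq_iff {E : Type*} {j : ℤ} {n : ℕ} {σ τ : ℤ → E} :
    window j n σ = window j n τ ↔ ∀ i, j ≤ i → i < j + n → σ i = τ i := by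
  constructor
  · intro h i h1 h2
    have := congrFun h ⟨(i - j).toNat, by omega⟩
    simp only [window] at this
    rwa [show j + (((i - j).toNat : ℕ) : ℤ) = i by omega] at this
  · intro h
    funext i
    exact h _ (by omega) (by have := i.2; omega)

theorem window_succ_eq_snoc {E : Type*} (j : ℤ) (n : ℕ) (σ : ℤ → E) :
    window j (n + 1) σ = Fin.snoc (α := fun _ => E) (window j n σ) (σ (j + n)) := by
  funext i
  refine Fin.lastCases ?_ (fun i => ?_) i
  · simp [window]
  · simp [window]

theorem window_succ_eq_cons {E : Type*} (j : ℤ) (n : ℕ) (σ : ℤ → E) :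
    window j (n + 1) σ = Fin.cons (α := fun _ => E) (σ j) (window (j + 1) n σ) := by
  funext i
  refine Fin.cases ?_ (fun i => ?_) i
  · simp [window]
  · simp only [window, Fin.val_succ, Fin.cons_succ]
    congr 1
    push_cast
    ring

theorem measurable_window {E : Type*} [MeasurableSpace E] (j : ℤ) (n : ℕ) :
    Measurable (window (E := E) j n) :=
  measurable_pi_lambda _ fun _ => measurable_pi_apply _

theorem codeShift_iterate {E : Type*} (n : ℕ) (σ : ℤ → E) :
    (codeShift E)^[n] σ = fun k => σ (k + n) := by
  induction n with
  | zero => simp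
  | succ n ih =>
    rw [Function.iterate_succ_apply', ih]
    funext k
    simp only [codeShift, Equiv.coe_fn_mk]
    congr 1
    push_cast
    ring

theorem measurable_codeShift {E : Type*} [MeasurableSpace E] : Measurable (codeShift E) :=
  measurable_pi_lambda _ fun _ => measurable_pi_apply _

theorem measurable_itinerary {E : Type*} [MeasurableSpace E] {k : ℕ} {ξ : (ℤ → E) → Fin k} (hξ : Measurable ξ) (N : ℕ) :
    Measurable (itinerary (codeShift E) ξ N) :=
  measurable_pi_lambda _ fun j => hξ.comp (measurable_codeShift.iterate j)

/-- Membership depends on finitely many coordinates, and the sum of their absolute values bounds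
each of them. Quantifying over all m ≥ m₀ allows the window to be enlarged later. -/
theorem exists_window_of_mem_measurableCylinders {E : Type*} [MeasurableSpace E]
    {B : Set (ℤ → E)} (hB : B ∈ measurableCylinders fun _ : ℤ => E) :
    ∃ m₀ : ℕ, ∀ m, m₀ ≤ m → ∀ σ τ,
      window (-(m : ℤ)) (2 * m + 1) σ = window (-(m : ℤ)) (2 * m + 1) τ → (σ ∈ B ↔ τ ∈ B) := by
  rw [mem_measurableCylinders] at hB
  obtain ⟨s, S, -, rfl⟩ := hB
  refine ⟨∑ i ∈ s, i.natAbs, ?_⟩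
  intro m hm σ τ h
  rw [window_eq_iff] at h
  have : s.restrict σ = s.restrict τ := by
    funext i
    have h1 : (i : ℤ).natAbs ≤ m :=
      (Finset.single_le_sum (f := fun i : ℤ => i.natAbs) (fun _ _ => Nat.zero_le _) i.2).trans hm
    exact h i (by omega) (by push_cast; omega)
  rw [mem_cylinder, mem_cylinder, this]

/-- Cylinders form a ring generating the σ-algebra, hence are dense in measure. -/
theorem exists_window_set_approx {E : Type*} [MeasurableSpace E] (Λ : Measure (ℤ → E)) [IsProbabilityMeasure Λ]
    {A : Set (ℤ → E)} (hA : MeasurableSet A) {ε : ℝ} (hε : 0 < ε) :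
    ∃ (B : Set (ℤ → E)) (m₀ : ℕ), Λ.real (symmDiff B A) < ε ∧
      ∀ m, m₀ ≤ m → ∀ σ τ, window (-(m : ℤ)) (2 * m + 1) σ = window (-(m : ℤ)) (2 * m + 1) τ →
        (σ ∈ B ↔ τ ∈ B) := by
  obtain ⟨B, hB, hlt⟩ := exists_measure_symmDiff_lt_of_generateFrom_isSetRing (μ := Λ)
    (C := measurableCylinders fun _ : ℤ => E) (isSetRing_measurableCylinders (α := fun _ : ℤ => E))
    ⟨{univ}, countable_singleton _,
      singleton_subset_iff.2 (univ_mem_measurableCylinders fun _ : ℤ => E), by simp⟩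
    generateFrom_measurableCylinders.symm hA (ε := ENNReal.ofReal ε) (by simpa using hε)
  obtain ⟨m₀, hm₀⟩ := exists_window_of_mem_measurableCylinders hB
  refine ⟨B, m₀, ?_, hm₀⟩
  rw [measureReal_def]
  exact ENNReal.toReal_lt_of_lt_ofReal hlt

section Factors

variable {X : Type*} [MeasurableSpace X] {μ : Measure X} [IsProbabilityMeasure μ]
  {ι : Type*} [Fintype ι] [MeasurableSpace ι] [MeasurableSingletonClass ι]

theorem integrable_of_factors {Z : X → ι} (hZ : Measurable Z) (f : X → ℝ)
    (hf : ∀ x y, Z x = Z y → f x = f y) : Integrable f μ := by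
  have hf' : Function.FactorsThrough f Z := fun x y h => hf x y h
  have : f = fun x => Function.extend Z f 0 (Z x) := by
    funext x; exact (hf'.extend_apply 0 x).symm
  rw [this]
  exact integrable_comp_finite hZ _

end Factors

/-! ### Entropy of the shift and the loss of finite-memory predictors -/

section CodeSpace

variable {E : Type*} [Fintype E] [MeasurableSpace E] [DiscreteMeasurableSpace E]

/-- A finite measurable partition of the code space can be predicted from a long block, with
arbitrarily small expected logarithmic loss. -/
theorem exists_window_kernel (Λ : Measure (ℤ → E)) [IsProbabilityMeasure Λ] {k : ℕ}
    {ξ : (ℤ → E) → Fin k} (hξ : Measurable ξ) {η : ℝ} (hη : 0 < η) :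
    ∃ (m₀ : ℕ) (ρ : (ℤ → E) → Fin k → ℝ), (∀ σ c, 0 < ρ σ c) ∧ (∀ σ, ∑ c, ρ σ c = 1) ∧
      (∀ m, m₀ ≤ m → ∀ σ τ, window (-(m : ℤ)) (2 * m + 1) σ = window (-(m : ℤ)) (2 * m + 1) τ →
        ρ σ = ρ τ) ∧
      ∫ σ, -Real.log (ρ σ (ξ σ)) ∂Λ ≤ η := by
  classical
  obtain ⟨σ₀⟩ : Nonempty (ℤ → E) := nonempty_of_isProbabilityMeasure Λ
  have hk : 0 < (k : ℝ) := by
    have := (ξ σ₀).pos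
    exact_mod_cast this
  have hk1 : 1 ≤ (k : ℝ) := by
    have := (ξ σ₀).pos
    exact_mod_cast this
  -- The budget η is split in two. The floor t, which keeps every prediction positive, costs at most
  -- k t = η/2 where the prediction is right. L bounds the loss everywhere, and ε is chosen so that
  -- the set of wrong predictions, of measure at most k ε, costs at most η/2.
  set t : ℝ := η / (2 * k) with ht
  have ht0 : 0 < t := by positivity
  set L : ℝ := Real.log (k * (1 + t) / t) with hL
  have hL0 : 0 ≤ L := by
    apply Real.log_nonneg
    rw [le_div_iff₀ ht0]
    nlinarith
  set ε : ℝ := η / (2 * k * (L + 1)) with hε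
  have hε0 : 0 < ε := by positivity
  choose B m₁ hB hBw using fun c : Fin k =>
    exists_window_set_approx Λ (hξ (measurableSet_singleton c)) hε0
  -- Unnormalised prediction: the indicator of the window approximation of each cell, raised by t.
  set b : (ℤ → E) → Fin k → ℝ := fun σ c => (if σ ∈ B c then 1 else 0) + t with hb
  have hb0 : ∀ σ c, t ≤ b σ c := by
    intro σ c; simp only [hb]; split_ifs <;> linarith
  have hb1 : ∀ σ c, b σ c ≤ 1 + t := by
    intro σ c; simp only [hb]; split_ifs <;> linarith
  have hsum0 : ∀ σ, 0 < ∑ c, b σ c := fun σ =>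
    Finset.sum_pos (fun c _ => ht0.trans_le (hb0 σ c)) ⟨ξ σ₀, Finset.mem_univ _⟩
  have hsum1 : ∀ σ, ∑ c, b σ c ≤ k * (1 + t) := by
    intro σ
    calc ∑ c, b σ c ≤ ∑ _c : Fin k, (1 + t) := Finset.sum_le_sum fun c _ => hb1 σ c
      _ = k * (1 + t) := by simp [mul_add]
  set ρ : (ℤ → E) → Fin k → ℝ := fun σ c => b σ c / ∑ c', b σ c' with hρ
  have hρ0 : ∀ σ c, 0 < ρ σ c := fun σ c => div_pos (ht0.trans_le (hb0 σ c)) (hsum0 σ)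
  have hρw : ∀ m, ∑ c, m₁ c ≤ m → ∀ σ τ,
      window (-(m : ℤ)) (2 * m + 1) σ = window (-(m : ℤ)) (2 * m + 1) τ → ρ σ = ρ τ := by
    intro m hm σ τ h
    have : b σ = b τ := by
      funext c
      have hc : m₁ c ≤ m :=
        (Finset.single_le_sum (fun _ _ => Nat.zero_le _) (Finset.mem_univ c)).trans hm
      simp only [hb, hBw c m hc σ τ h]
    simp only [hρ, this]
  refine ⟨∑ c, m₁ c, ρ, hρ0, ?_, hρw, ?_⟩
  · intro σ
    rw [← Finset.sum_div, div_self (hsum0 σ).ne']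
  -- Measurable hulls are used so that the indicator of the exceptional set is integrable without
  -- measurability of `B c`.
  set bad : Set (ℤ → E) := ⋃ c, toMeasurable Λ (symmDiff (B c) (ξ ⁻¹' {c})) with hbad
  have hbadm : MeasurableSet bad := MeasurableSet.iUnion fun c => measurableSet_toMeasurable _ _
  have hbadle : Λ.real bad ≤ k * ε := by
    calc Λ.real bad ≤ ∑ c, Λ.real (toMeasurable Λ (symmDiff (B c) (ξ ⁻¹' {c}))) :=
          measureReal_iUnion_fintype_le _
      _ ≤ ∑ _c : Fin k, ε := Finset.sum_le_sum fun c _ => by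
          rw [measureReal_def, measure_toMeasurable]
          exact (hB c).le
      _ = k * ε := by simp
  have hpt : ∀ σ, -Real.log (ρ σ (ξ σ)) ≤ k * t + bad.indicator (fun _ => L) σ := by
    intro σ
    by_cases hσ : σ ∈ bad
    · rw [indicator_of_mem hσ]
      have h1 : (k * (1 + t) / t)⁻¹ ≤ ρ σ (ξ σ) := by
        rw [inv_div]
        exact div_le_div₀ (ht0.le.trans (hb0 σ _)) (hb0 σ _) (hsum0 σ) (hsum1 σ)
      have h2 := Real.log_le_log (by positivity) h1
      rw [Real.log_inv] at h2
      have : 0 ≤ k * t := by positivity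
      linarith
    · rw [indicator_of_notMem hσ, add_zero]
      have hgood : ∀ c, σ ∈ B c ↔ ξ σ = c := by
        intro c
        have : σ ∉ symmDiff (B c) (ξ ⁻¹' {c}) := fun h =>
          hσ (mem_iUnion.2 ⟨c, subset_toMeasurable _ _ h⟩)
        rw [mem_symmDiff] at this
        simp only [mem_preimage, mem_singleton_iff] at this
        tauto
      have h1 : b σ (ξ σ) = 1 + t := by simp [hb, hgood]
      have h2 : ∑ c, b σ c = 1 + k * t := by
        simp only [hb, hgood, Finset.sum_add_distrib]
        simp
      have h3 : ρ σ (ξ σ) = (1 + t) / (1 + k * t) := by simp only [hρ, h1, h2]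
      have h4 : 0 < 1 + k * t := by positivity
      rw [h3, Real.log_div (by positivity) h4.ne']
      have h5 := Real.log_le_sub_one_of_pos h4
      have h6 : 0 ≤ Real.log (1 + t) := Real.log_nonneg (by linarith)
      linarith
  have hint : Integrable (fun σ => -Real.log (ρ σ (ξ σ))) Λ := by
    refine integrable_of_factors ((measurable_window (-((∑ c, m₁ c : ℕ) : ℤ))
      (2 * (∑ c, m₁ c) + 1)).prodMk hξ) _ ?_
    intro σ τ h
    rw [Prod.mk.injEq] at h
    rw [hρw _ le_rfl σ τ h.1, h.2]
  have hint2 : Integrable (bad.indicator fun _ => L) Λ := (integrable_const L).indicator hbadm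
  calc ∫ σ, -Real.log (ρ σ (ξ σ)) ∂Λ ≤ ∫ σ, (k * t + bad.indicator (fun _ => L) σ) ∂Λ :=
        integral_mono hint ((integrable_const _).add hint2) hpt
    _ = k * t + Λ.real bad * L := by
        rw [integral_add (integrable_const _) hint2, integral_indicator_const _ hbadm]
        simp
    _ ≤ k * t + k * ε * L := by gcongr
    _ ≤ η / 2 + η / 2 := by
        refine add_le_add (le_of_eq ?_) ?_
        · rw [ht]; field_simp
        · rw [hε, show k * (η / (2 * k * (L + 1))) * L = η / 2 * (L / (L + 1)) by field_simp]
          have : L / (L + 1) ≤ 1 := by rw [div_le_one (by positivity)]; linarith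
          nlinarith
    _ = η := by ring

/-- If `q σ` is a subprobability vector on `E` depending on `σ_{-n}, …, σ_0` only, then the entropy
of the shift is at most the expected logarithmic loss of predicting `σ_1` by `q`. -/
theorem ksEntropy_codeShift_le {Λ : Measure (ℤ → E)} (hΛ : Λ ∈ invariantProb (codeShift E))
    (q : (ℤ → E) → E → ℝ) (n : ℕ)
    (hq : ∀ σ τ, window (-(n : ℤ)) (n + 1) σ = window (-(n : ℤ)) (n + 1) τ → q σ = q τ)
    (hq0 : ∀ σ e, 0 ≤ q σ e) (hq1 : ∀ σ, ∑ e, q σ e ≤ 1)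
    (hpos : ∀ᵐ σ ∂Λ, 0 < q σ (σ 1)) :
    ksEntropy (codeShift E) Λ ≤ ((∫ σ, -Real.log (q σ (σ 1)) ∂Λ : ℝ) : EReal) := by
  obtain ⟨hprob, hS⟩ := hΛ
  set B : ℝ := ∫ σ, -Real.log (q σ (σ 1)) ∂Λ with hB
  have hqint : Integrable (fun σ => -Real.log (q σ (σ 1))) Λ := by
    refine integrable_of_factors ((measurable_window (-(n : ℤ)) (n + 1)).prodMk
      (measurable_pi_apply (1 : ℤ))) _ ?_
    intro σ τ h
    rw [Prod.mk.injEq] at h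
    rw [hq σ τ h.1, h.2]
  refine iSup_le fun k => iSup_le fun ξ => iSup_le fun hξ => ?_
  have main : ∀ η : ℝ, 0 < η → entropyOfPartition (codeShift E) Λ ξ ≤ ((B + 2 * η : ℝ) : EReal) := by
    intro η hη
    obtain ⟨m₀, ρ, hρ0, hρ1, hρw, hρint⟩ := exists_window_kernel Λ hξ hη
    -- One radius serves both predictors: the partition ξ needs m ≥ m₀, the predictor q needs m ≥ n.
    set m : ℕ := max m₀ n with hm
    have hρi : Integrable (fun σ => -Real.log (ρ σ (ξ σ))) Λ := by
      refine integrable_of_factors ((measurable_window (-(m : ℤ)) (2 * m + 1)).prodMk hξ) _ ?_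
      intro σ τ h
      rw [Prod.mk.injEq] at h
      rw [hρw m (le_max_left _ _) σ τ h.1, h.2]
    -- The itinerary is carried together with the letters σ_{-m}, …, σ_{m+N}. They contain the
    -- window [N-m, N+m] that predicts ξ(S^N σ), and the window [m+N-n, m+N] that predicts the next
    -- letter. One step thus costs at most η + B.
    set Z : (N : ℕ) → (ℤ → E) → (Fin N → Fin k) × (Fin (2 * m + 1 + N) → E) :=
      fun N σ => (itinerary (codeShift E) ξ N σ, window (-(m : ℤ)) (2 * m + 1 + N) σ) with hZ
    have hZm : ∀ N, Measurable (Z N) := fun N =>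
      (measurable_itinerary hξ N).prodMk (measurable_window _ _)
    have hstep : ∀ N, partitionEntropy Λ (Z (N + 1)) ≤ partitionEntropy Λ (Z N) + (B + η) := by
      intro N
      set W : (ℤ → E) → Fin k × E :=
        fun σ => (ξ ((codeShift E)^[N] σ), σ (m + N + 1)) with hW
      have hWm : Measurable W := (hξ.comp (measurable_codeShift.iterate N)).prodMk
        (measurable_pi_apply _)
      have hSN := hS.iterate N
      have hSM := hS.iterate (m + N)
      have hval : ∀ σ : ℤ → E, σ (m + N + 1) = (codeShift E)^[m + N] σ 1 := by
        intro σ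
        rw [codeShift_iterate]
        congr 1
        push_cast
        ring
      have h1 : partitionEntropy Λ (Z (N + 1)) ≤ partitionEntropy Λ (fun σ => (Z N σ, W σ)) := by
        refine partitionEntropy_le_of_factor ((hZm N).prodMk hWm)
          (fun p => (Fin.snoc (α := fun _ => Fin k) p.1.1 p.2.1,
            Fin.snoc (α := fun _ => E) p.1.2 p.2.2)) ?_
        intro σ
        refine Prod.ext ?_ ?_
        · funext j
          refine Fin.lastCases ?_ (fun j => ?_) j
          · simp [hZ, hW, itinerary]
          · simp [hZ, itinerary]
        · change window (-(m : ℤ)) (2 * m + 1 + N + 1) σ = _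
          rw [window_succ_eq_snoc]
          simp only [hZ, hW]
          congr 2
          push_cast
          ring
      have hpos' : ∀ᵐ σ ∂Λ, 0 < q ((codeShift E)^[m + N] σ) ((codeShift E)^[m + N] σ 1) :=
        hSM.quasiMeasurePreserving.ae hpos
      have h2 := partitionEntropy_prod_le' (μ := Λ) (hZm N) hWm
        (fun σ p => ρ ((codeShift E)^[N] σ) p.1 * q ((codeShift E)^[m + N] σ) p.2) ?_ ?_ ?_ ?_
      · refine h1.trans (h2.trans (add_le_add le_rfl ?_))
        have hi1 : Integrable
            (fun σ => -Real.log (ρ ((codeShift E)^[N] σ) (ξ ((codeShift E)^[N] σ)))) Λ :=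
          hSN.integrable_comp_of_integrable hρi
        have hi2 : Integrable (fun σ => -Real.log (q ((codeShift E)^[m + N] σ)
            ((codeShift E)^[m + N] σ 1))) Λ := hSM.integrable_comp_of_integrable hqint
        have e1 : ∫ σ, -Real.log (ρ ((codeShift E)^[N] σ) (ξ ((codeShift E)^[N] σ))) ∂Λ =
            ∫ σ, -Real.log (ρ σ (ξ σ)) ∂Λ := by
          conv_rhs => rw [← hSN.map_eq]
          rw [integral_map hSN.measurable.aemeasurable]
          rw [hSN.map_eq]
          exact hρi.aestronglyMeasurable
        have e2 : ∫ σ, -Real.log (q ((codeShift E)^[m + N] σ) ((codeShift E)^[m + N] σ 1)) ∂Λ =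
            B := by
          rw [hB]
          conv_rhs => rw [← hSM.map_eq]
          rw [integral_map hSM.measurable.aemeasurable]
          rw [hSM.map_eq]
          exact hqint.aestronglyMeasurable
        calc _ = ∫ σ, (-Real.log (q ((codeShift E)^[m + N] σ) ((codeShift E)^[m + N] σ 1)) +
              -Real.log (ρ ((codeShift E)^[N] σ) (ξ ((codeShift E)^[N] σ)))) ∂Λ := by
              refine integral_congr_ae ?_
              filter_upwards [hpos'] with σ hσ
              simp only [hW]
              rw [hval σ, Real.log_mul (hρ0 _ _).ne' hσ.ne']
              ring
          _ = B + ∫ σ, -Real.log (ρ σ (ξ σ)) ∂Λ := by rw [integral_add hi2 hi1, e1, e2]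
          _ ≤ B + η := by linarith
      · intro σ τ h
        have hw : window (-(m : ℤ)) (2 * m + 1 + N) σ = window (-(m : ℤ)) (2 * m + 1 + N) τ :=
          (Prod.mk.injEq _ _ _ _ ▸ h : _ ∧ _).2
        rw [window_eq_iff] at hw
        have g1 : ρ ((codeShift E)^[N] σ) = ρ ((codeShift E)^[N] τ) := by
          refine hρw m (le_max_left _ _) _ _ (window_eq_iff.2 fun i h1 h2 => ?_)
          rw [codeShift_iterate, codeShift_iterate]
          exact hw _ (by omega) (by push_cast at h2 ⊢; omega)
        have g2 : q ((codeShift E)^[m + N] σ) = q ((codeShift E)^[m + N] τ) := by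
          refine hq _ _ (window_eq_iff.2 fun i h1 h2 => ?_)
          rw [codeShift_iterate, codeShift_iterate]
          have : n ≤ m := le_max_right _ _
          exact hw _ (by push_cast; omega) (by push_cast at h2 ⊢; omega)
        rw [g1, g2]
      · exact fun σ p => mul_nonneg (hρ0 _ _).le (hq0 _ _)
      · intro σ
        rw [Fintype.sum_prod_type]
        simp_rw [← Finset.mul_sum]
        rw [← Finset.sum_mul, hρ1, one_mul]
        exact hq1 _
      · filter_upwards [hpos'] with σ hσ
        refine mul_pos (hρ0 _ _) ?_
        simp only [hW]
        rw [hval σ]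
        exact hσ
    have hbound : ∀ N : ℕ, partitionEntropy Λ (itinerary (codeShift E) ξ N) ≤
        partitionEntropy Λ (Z 0) + N * (B + η) := by
      intro N
      refine (partitionEntropy_le_of_factor (hZm N) Prod.fst fun σ => rfl).trans ?_
      induction N with
      | zero => simp
      | succ N ih =>
        refine (hstep N).trans ?_
        push_cast
        linarith
    refine limsup_le_of_le (by isBoundedDefault) ?_
    -- The initial entropy H(Z₀) is constant, so for large N it adds at most η to the entropy per
    -- step.
    obtain ⟨N₀, hN₀⟩ := exists_nat_gt (partitionEntropy Λ (Z 0) / η)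
    filter_upwards [eventually_ge_atTop (N₀ + 1)] with N hN
    have hNpos : 0 < (N : ℝ) := by
      have : 0 < N := by omega
      exact_mod_cast this
    rw [EReal.coe_le_coe_iff, div_le_iff₀ hNpos]
    have h1 : partitionEntropy Λ (Z 0) ≤ N * η := by
      rw [← div_le_iff₀ hη]
      refine hN₀.le.trans ?_
      exact_mod_cast (by omega : N₀ ≤ N)
    nlinarith [hbound N]
  refine le_of_forall_gt_imp_ge_of_dense fun c hc => ?_
  obtain ⟨d, hd1, hd2⟩ := EReal.lt_iff_exists_real_btwn.1 hc
  rw [EReal.coe_lt_coe_iff] at hd1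
  refine (main ((d - B) / 2) (by linarith)).trans (le_trans (le_of_eq ?_) hd2.le)
  congr 1
  ring

end CodeSpace

/-! ### Finite words of a Markov system -/

theorem sum_word_succ_cons {E : Type*} [Fintype E] {n : ℕ} (f : (Fin (n + 1) → E) → ℝ) :
    ∑ u, f u = ∑ e, ∑ u : Fin n → E, f (Fin.cons e u) := by
  rw [← Fintype.sum_prod_type', ← (Fin.consEquiv fun _ : Fin (n + 1) => E).sum_comp]
  rfl

theorem sum_word_succ_snoc {E : Type*} [Fintype E] {n : ℕ} (f : (Fin (n + 1) → E) → ℝ) :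
    ∑ u, f u = ∑ u : Fin n → E, ∑ e, f (Fin.snoc (α := fun _ => E) u e) := by
  rw [Finset.sum_comm, ← Fintype.sum_prod_type',
    ← (Fin.snocEquiv fun _ : Fin (n + 1) => E).sum_comp]
  rfl

namespace MarkovSystem

variable {V E K : Type*} [Fintype E] [MeasurableSpace K]

/-- The probability that the Markov system started at `y` follows the word `u`. -/
noncomputable def wordProb (𝓜 : MarkovSystem V E K) : {n : ℕ} → (Fin n → E) → K → ℝ
  | 0, _, _ => 1
  | _ + 1, u, y => 𝓜.p (u 0) y * 𝓜.wordProb (Fin.tail u) (𝓜.w (u 0) y)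

/-- The point reached from `y` along the word `u`. -/
def wordMap (𝓜 : MarkovSystem V E K) : {n : ℕ} → (Fin n → E) → K → K
  | 0, _, y => y
  | _ + 1, u, y => 𝓜.wordMap (Fin.tail u) (𝓜.w (u 0) y)

/-- The probability of the word `u` for the Markov system with initial distribution `μ`. -/
noncomputable def blockProb (𝓜 : MarkovSystem V E K) (μ : Measure K) {n : ℕ} (u : Fin n → E) : ℝ :=
  ∫ y, 𝓜.wordProb u y ∂μ

/-- Two points lie in the same vertex set. -/
def SameCell (𝓜 : MarkovSystem V E K) (y z : K) : Prop :=
  ∃ v, y ∈ 𝓜.vertexSet v ∧ z ∈ 𝓜.vertexSet v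

variable (𝓜 : MarkovSystem V E K)

theorem mem_of_p_ne_zero {e : E} {y : K} (h : 𝓜.p e y ≠ 0) : y ∈ 𝓜.vertexSet (𝓜.ini e) := by
  by_contra hy
  exact h (𝓜.p_zero e y hy)

theorem eq_of_mem_vertexSet {v v' : V} {y : K} (h : y ∈ 𝓜.vertexSet v) (h' : y ∈ 𝓜.vertexSet v') :
    v = v' := by
  by_contra hne
  exact Set.disjoint_left.1 (𝓜.vertexSet_disjoint v v' hne) h h'

theorem exists_mem_vertexSet (y : K) : ∃ v, y ∈ 𝓜.vertexSet v := by
  have := mem_univ y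
  rwa [← 𝓜.vertexSet_cover, mem_iUnion] at this

theorem p_le_one (e : E) (y : K) : 𝓜.p e y ≤ 1 := by
  rw [← 𝓜.p_sum y]
  exact Finset.single_le_sum (fun e _ => 𝓜.p_nonneg e y) (Finset.mem_univ e)

variable {𝓜} in
-- Positivity of p_e(y) identifies the common cell as the initial cell of e, which w_e maps into a
-- single cell.
theorem SameCell.map {y z : K} (h : 𝓜.SameCell y z) {e : E} (he : 𝓜.p e y ≠ 0) :
    𝓜.SameCell (𝓜.w e y) (𝓜.w e z) := by
  obtain ⟨v, hy, hz⟩ := h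
  obtain rfl := 𝓜.eq_of_mem_vertexSet hy (𝓜.mem_of_p_ne_zero he)
  exact ⟨_, 𝓜.w_mapsTo e hy, 𝓜.w_mapsTo e hz⟩

theorem wordProb_cons {n : ℕ} (e : E) (u : Fin n → E) (y : K) :
    𝓜.wordProb (Fin.cons (α := fun _ => E) e u) y = 𝓜.p e y * 𝓜.wordProb u (𝓜.w e y) := by
  simp [wordProb]

theorem wordMap_cons {n : ℕ} (e : E) (u : Fin n → E) (y : K) :
    𝓜.wordMap (Fin.cons (α := fun _ => E) e u) y = 𝓜.wordMap u (𝓜.w e y) := by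
  simp [wordMap]

theorem wordMap_snoc {n : ℕ} (u : Fin n → E) (e : E) (y : K) :
    𝓜.wordMap (Fin.snoc (α := fun _ => E) u e) y = 𝓜.w e (𝓜.wordMap u y) := by
  induction n generalizing y with
  | zero => simp [wordMap, Fin.snoc]
  | succ n ih =>
    obtain ⟨⟨e', u⟩, rfl⟩ := (Fin.consEquiv fun _ : Fin (n + 1) => E).surjective u
    change 𝓜.wordMap (Fin.snoc (α := fun _ => E) (Fin.cons (α := fun _ => E) e' u) e) y =
      𝓜.w e (𝓜.wordMap (Fin.cons (α := fun _ => E) e' u) y)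
    rw [← Fin.cons_snoc_eq_snoc_cons, wordMap_cons, wordMap_cons, ih]

/-- The recursion peels off the first letter; splitting off the last one is what exposes the next
transition at the end point of the word. -/
theorem wordProb_snoc {n : ℕ} (u : Fin n → E) (e : E) (y : K) :
    𝓜.wordProb (Fin.snoc (α := fun _ => E) u e) y =
      𝓜.wordProb u y * 𝓜.p e (𝓜.wordMap u y) := by
  induction n generalizing y with
  | zero => simp [wordProb, wordMap, Fin.snoc]
  | succ n ih =>
    obtain ⟨⟨e', u⟩, rfl⟩ := (Fin.consEquiv fun _ : Fin (n + 1) => E).surjective u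
    change 𝓜.wordProb (Fin.snoc (α := fun _ => E) (Fin.cons (α := fun _ => E) e' u) e) y =
      𝓜.wordProb (Fin.cons (α := fun _ => E) e' u) y *
        𝓜.p e (𝓜.wordMap (Fin.cons (α := fun _ => E) e' u) y)
    rw [← Fin.cons_snoc_eq_snoc_cons, wordProb_cons, wordProb_cons, wordMap_cons, ih, mul_assoc]

theorem wordProb_nonneg {n : ℕ} (u : Fin n → E) (y : K) : 0 ≤ 𝓜.wordProb u y := by
  induction n generalizing y with
  | zero => simp [wordProb]
  | succ n ih => exact mul_nonneg (𝓜.p_nonneg _ _) (ih _ _)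

theorem sum_wordProb_succ {n : ℕ} (y : K) (f : (Fin (n + 1) → E) → ℝ) :
    ∑ u, 𝓜.wordProb u y * f u =
      ∑ e, 𝓜.p e y * ∑ u : Fin n → E, 𝓜.wordProb u (𝓜.w e y) * f (Fin.cons e u) := by
  rw [sum_word_succ_cons]
  simp_rw [Finset.mul_sum, wordProb_cons, mul_assoc]

theorem sum_wordProb (n : ℕ) (y : K) : ∑ u : Fin n → E, 𝓜.wordProb u y = 1 := by
  induction n generalizing y with
  | zero => simp [wordProb]
  | succ n ih =>
    have := 𝓜.sum_wordProb_succ (n := n) y fun _ => 1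
    simp only [mul_one] at this
    rw [this]
    simp [ih, 𝓜.p_sum]

theorem wordProb_le_one {n : ℕ} (u : Fin n → E) (y : K) : 𝓜.wordProb u y ≤ 1 := by
  rw [← 𝓜.sum_wordProb n y]
  exact Finset.single_le_sum (fun u _ => 𝓜.wordProb_nonneg u y) (Finset.mem_univ u)

theorem measurable_wordMap {n : ℕ} (u : Fin n → E) : Measurable (𝓜.wordMap u) := by
  induction n with
  | zero => exact measurable_id
  | succ n ih => exact (ih (Fin.tail u)).comp (𝓜.w_measurable _)

theorem measurable_wordProb {n : ℕ} (u : Fin n → E) : Measurable (𝓜.wordProb u) := by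
  induction n with
  | zero => exact measurable_const
  | succ n ih => exact (𝓜.p_measurable _).mul ((ih (Fin.tail u)).comp (𝓜.w_measurable _))

theorem measurable_markovOp {f : K → ℝ} (hf : Measurable f) : Measurable (𝓜.markovOp f) :=
  Finset.measurable_sum _ fun e _ => (𝓜.p_measurable e).mul (hf.comp (𝓜.w_measurable e))

theorem abs_markovOp_le {f : K → ℝ} {C : ℝ} (hC : ∀ y, |f y| ≤ C) (y : K) :
    |𝓜.markovOp f y| ≤ C := by
  calc |𝓜.markovOp f y| ≤ ∑ e, |𝓜.p e y * f (𝓜.w e y)| := Finset.abs_sum_le_sum_abs _ _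
    _ ≤ ∑ e, 𝓜.p e y * C := by
        refine Finset.sum_le_sum fun e _ => ?_
        rw [abs_mul, abs_of_nonneg (𝓜.p_nonneg e y)]
        exact mul_le_mul_of_nonneg_left (hC _) (𝓜.p_nonneg e y)
    _ = C := by rw [← Finset.sum_mul, 𝓜.p_sum, one_mul]

theorem SameCell.word {n : ℕ} {y z : K} (h : 𝓜.SameCell y z) {u : Fin n → E}
    (hu : 𝓜.wordProb u y ≠ 0) : 𝓜.SameCell (𝓜.wordMap u y) (𝓜.wordMap u z) := by
  induction n generalizing y z with
  | zero => exact h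
  | succ n ih => exact ih (h.map (left_ne_zero_of_mul hu)) (right_ne_zero_of_mul hu)

/-- Contraction on average along words. -/
theorem sum_wordProb_dist_le {K : Type*} [PseudoMetricSpace K] [MeasurableSpace K]
    {𝓜 : MarkovSystem V E K} {a : ℝ} (h : 𝓜.IsContractive a) (n : ℕ) {y z : K}
    (hyz : 𝓜.SameCell y z) :
    ∑ u : Fin n → E, 𝓜.wordProb u y * dist (𝓜.wordMap u y) (𝓜.wordMap u z) ≤
      a ^ n * dist y z := by
  induction n generalizing y z with
  | zero => simp [wordProb, wordMap]
  | succ n ih =>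
    rw [sum_wordProb_succ]
    simp_rw [wordMap_cons]
    calc _ ≤ ∑ e, 𝓜.p e y * (a ^ n * dist (𝓜.w e y) (𝓜.w e z)) := by
          refine Finset.sum_le_sum fun e _ => ?_
          by_cases he : 𝓜.p e y = 0
          · simp [he]
          · exact mul_le_mul_of_nonneg_left (ih (hyz.map he)) (𝓜.p_nonneg _ _)
      _ = a ^ n * ∑ e, 𝓜.p e y * dist (𝓜.w e y) (𝓜.w e z) := by
          rw [Finset.mul_sum]
          refine Finset.sum_congr rfl fun e _ => by ring
      _ ≤ a ^ n * (a * dist y z) := by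
          obtain ⟨v, hy, hz⟩ := hyz
          exact mul_le_mul_of_nonneg_left (h.2.2 v y hy z hz) (pow_nonneg h.1.le n)
      _ = a ^ (n + 1) * dist y z := by ring

theorem blockProb_nonneg (μ : Measure K) {n : ℕ} (u : Fin n → E) : 0 ≤ 𝓜.blockProb μ u :=
  integral_nonneg fun y => 𝓜.wordProb_nonneg u y

/-! ### Words of the system started from an invariant measure -/

section Invariant

variable {μ : Measure K} [IsProbabilityMeasure μ]

theorem integrable_of_abs_le {f : K → ℝ} (hf : Measurable f) {C : ℝ} (hC : ∀ y, |f y| ≤ C) :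
    Integrable f μ :=
  Integrable.of_bound hf.aestronglyMeasurable C (ae_of_all _ hC)

variable {𝓜}

theorem integral_markovOp (h_inv : 𝓜.adjointOp μ = μ) {f : K → ℝ} (hf : Measurable f) {C : ℝ}
    (hC : ∀ y, |f y| ≤ C) : ∫ y, 𝓜.markovOp f y ∂μ = ∫ y, f y ∂μ := by
  rw [← 𝓜.integral_adjointOp μ f hf C hC, h_inv]

theorem abs_wordProb_le {n : ℕ} (u : Fin n → E) (y : K) : |𝓜.wordProb u y| ≤ 1 := by
  rw [abs_of_nonneg (𝓜.wordProb_nonneg u y)]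
  exact 𝓜.wordProb_le_one u y

theorem integrable_wordProb {n : ℕ} (u : Fin n → E) : Integrable (𝓜.wordProb u) μ :=
  integrable_of_abs_le (𝓜.measurable_wordProb u) (abs_wordProb_le u)

variable (𝓜 μ) in
theorem sum_blockProb (n : ℕ) : ∑ u : Fin n → E, 𝓜.blockProb μ u = 1 := by
  unfold blockProb
  rw [← integral_finsetSum _ fun u _ => integrable_wordProb u]
  simp [sum_wordProb]

variable (𝓜 μ) in
-- Consistency on the right needs only ∑ p_e = 1, while consistency on the left
-- (`sum_blockProb_cons`) is exactly where the invariance of μ enters.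
theorem sum_blockProb_snoc {n : ℕ} (u : Fin n → E) :
    ∑ e, 𝓜.blockProb μ (Fin.snoc (α := fun _ => E) u e) = 𝓜.blockProb μ u := by
  unfold blockProb
  rw [← integral_finsetSum _ fun e _ => integrable_wordProb _]
  refine integral_congr_ae (ae_of_all _ fun y => ?_)
  simp only [wordProb_snoc]
  rw [← Finset.mul_sum, 𝓜.p_sum, mul_one]

theorem sum_blockProb_cons (h_inv : 𝓜.adjointOp μ = μ) {n : ℕ} (u : Fin n → E) :
    ∑ e, 𝓜.blockProb μ (Fin.cons (α := fun _ => E) e u) = 𝓜.blockProb μ u := by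
  unfold blockProb
  rw [← integral_finsetSum _ fun e _ => integrable_wordProb _,
    ← integral_markovOp h_inv (𝓜.measurable_wordProb u) (abs_wordProb_le u)]
  simp only [wordProb_cons, markovOp]

/-- Started from μ, the position after n steps is again distributed as μ: peeling off the last
letter replaces f by Uf. -/
theorem integral_sum_wordProb (h_inv : 𝓜.adjointOp μ = μ) (n : ℕ) {f : K → ℝ} (hf : Measurable f)
    {C : ℝ} (hC : ∀ y, |f y| ≤ C) :
    ∫ y, ∑ u : Fin n → E, 𝓜.wordProb u y * f (𝓜.wordMap u y) ∂μ = ∫ y, f y ∂μ := by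
  induction n generalizing f with
  | zero => simp [wordProb, wordMap]
  | succ n ih =>
    rw [← integral_markovOp h_inv hf hC, ← ih (𝓜.measurable_markovOp hf) (𝓜.abs_markovOp_le hC)]
    refine integral_congr_ae (ae_of_all _ fun y => ?_)
    simp only
    rw [sum_word_succ_snoc]
    refine Finset.sum_congr rfl fun u _ => ?_
    simp only [wordProb_snoc, wordMap_snoc, markovOp, Finset.mul_sum, mul_assoc]

end Invariant

/-- The entropy of the choice of an edge at `y`. -/
noncomputable def stepEntropy (𝓜 : MarkovSystem V E K) (y : K) : ℝ :=
  ∑ e, Real.negMulLog (𝓜.p e y)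

theorem abs_negMulLog_le_one {t : ℝ} (h0 : 0 ≤ t) (h1 : t ≤ 1) : |Real.negMulLog t| ≤ 1 := by
  rw [abs_of_nonneg (Real.negMulLog_nonneg h0 h1)]
  exact (Real.negMulLog_le_one_sub_self h0).trans (by linarith)

theorem measurable_stepEntropy : Measurable 𝓜.stepEntropy :=
  Finset.measurable_sum _ fun e _ => Real.continuous_negMulLog.measurable.comp (𝓜.p_measurable e)

theorem abs_stepEntropy_le (y : K) : |𝓜.stepEntropy y| ≤ Fintype.card E := by
  calc |𝓜.stepEntropy y| ≤ ∑ e, |Real.negMulLog (𝓜.p e y)| := Finset.abs_sum_le_sum_abs _ _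
    _ ≤ ∑ _e : E, 1 := Finset.sum_le_sum fun e _ =>
        abs_negMulLog_le_one (𝓜.p_nonneg e y) (𝓜.p_le_one e y)
    _ = Fintype.card E := by simp

theorem measurable_negMulLog_wordProb {n : ℕ} (u : Fin n → E) :
    Measurable fun y => Real.negMulLog (𝓜.wordProb u y) :=
  Real.continuous_negMulLog.measurable.comp (𝓜.measurable_wordProb u)

theorem abs_negMulLog_wordProb_le {n : ℕ} (u : Fin n → E) (y : K) :
    |Real.negMulLog (𝓜.wordProb u y)| ≤ 1 :=
  abs_negMulLog_le_one (𝓜.wordProb_nonneg u y) (𝓜.wordProb_le_one u y)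

/-- Chain rule for entropy: choose the first edge, then a word from the point it leads to. -/
theorem sum_negMulLog_wordProb_succ (n : ℕ) (y : K) :
    ∑ u : Fin (n + 1) → E, Real.negMulLog (𝓜.wordProb u y) =
      𝓜.stepEntropy y +
        𝓜.markovOp (fun z => ∑ u : Fin n → E, Real.negMulLog (𝓜.wordProb u z)) y := by
  rw [sum_word_succ_cons]
  simp only [wordProb_cons, Real.negMulLog_mul, stepEntropy, markovOp]
  rw [← Finset.sum_add_distrib]
  refine Finset.sum_congr rfl fun e _ => ?_
  rw [Finset.sum_add_distrib, ← Finset.sum_mul, 𝓜.sum_wordProb, one_mul, Finset.mul_sum]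

theorem integral_sum_negMulLog_wordProb {μ : Measure K} [IsProbabilityMeasure μ]
    (h_inv : 𝓜.adjointOp μ = μ) (n : ℕ) :
    ∫ y, ∑ u : Fin n → E, Real.negMulLog (𝓜.wordProb u y) ∂μ = n * ∫ y, 𝓜.stepEntropy y ∂μ := by
  induction n with
  | zero => simp [wordProb]
  | succ n ih =>
    have hm : Measurable fun z => ∑ u : Fin n → E, Real.negMulLog (𝓜.wordProb u z) :=
      Finset.measurable_sum _ fun u _ => 𝓜.measurable_negMulLog_wordProb u
    have hC : ∀ z, |∑ u : Fin n → E, Real.negMulLog (𝓜.wordProb u z)| ≤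
        ∑ _u : Fin n → E, 1 := fun z =>
      (Finset.abs_sum_le_sum_abs _ _).trans
        (Finset.sum_le_sum fun u _ => 𝓜.abs_negMulLog_wordProb_le u z)
    simp_rw [sum_negMulLog_wordProb_succ]
    rw [integral_add (integrable_of_abs_le 𝓜.measurable_stepEntropy 𝓜.abs_stepEntropy_le)
      (integrable_of_abs_le (𝓜.measurable_markovOp hm) (𝓜.abs_markovOp_le hC)),
      integral_markovOp h_inv hm hC, ih]
    push_cast
    ring

/-- Blocks of the stationary Markov system have entropy at least `n` times the mean entropy of a
single step. -/
theorem le_sum_negMulLog_blockProb {μ : Measure K} [IsProbabilityMeasure μ]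
    (h_inv : 𝓜.adjointOp μ = μ) (n : ℕ) :
    n * ∫ y, 𝓜.stepEntropy y ∂μ ≤ ∑ u : Fin n → E, Real.negMulLog (𝓜.blockProb μ u) := by
  have hi : ∀ u : Fin n → E, Integrable (fun y => Real.negMulLog (𝓜.wordProb u y)) μ := fun u =>
    integrable_of_abs_le (𝓜.measurable_negMulLog_wordProb u) (𝓜.abs_negMulLog_wordProb_le u)
  rw [← 𝓜.integral_sum_negMulLog_wordProb h_inv, integral_finsetSum _ fun u _ => hi u]
  refine Finset.sum_le_sum fun u _ => ?_
  -- Jensen: averaging the word probabilities over the starting point can only increase the entropy.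
  exact Real.concaveOn_negMulLog.le_map_integral Real.continuous_negMulLog.continuousOn isClosed_Ici
    (ae_of_all _ fun y => 𝓜.wordProb_nonneg u y) (integrable_wordProb u) (hi u)

end MarkovSystem

/-! ### The stationary measure on the code space -/

/-- The translation of two-sided sequences by `j`. -/
def shiftBy (E : Type*) (j : ℤ) (σ : ℤ → E) : ℤ → E := fun k => σ (k + j)

theorem measurable_shiftBy {E : Type*} [MeasurableSpace E] (j : ℤ) : Measurable (shiftBy E j) :=
  measurable_pi_lambda _ fun _ => measurable_pi_apply _

section WindowLaw

variable {E : Type*} [Fintype E] [MeasurableSpace E] [DiscreteMeasurableSpace E]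

theorem measurableSet_window_fiber (j : ℤ) {n : ℕ} (u : Fin n → E) :
    MeasurableSet (window j n ⁻¹' {u}) :=
  measurable_window j n (measurableSet_singleton u)

theorem measureReal_window_eq_sum_snoc (ν : Measure (ℤ → E)) [IsProbabilityMeasure ν] (j : ℤ)
    {n : ℕ} (u : Fin n → E) :
    ν.real (window j n ⁻¹' {u}) =
      ∑ e, ν.real (window j (n + 1) ⁻¹' {Fin.snoc (α := fun _ => E) u e}) := by
  rw [← measureReal_biUnion_finset]
  · congr 1
    ext σ
    simp only [mem_preimage, mem_singleton_iff, Finset.mem_univ, iUnion_true, mem_iUnion,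
      window_succ_eq_snoc, Fin.snoc_inj]
    simp
  · intro e _ e' _ hne
    refine Set.disjoint_left.2 fun σ h h' => hne ?_
    simp only [mem_preimage, mem_singleton_iff] at h h'
    exact (Fin.snoc_inj.1 (h.symm.trans h')).2
  · exact fun e _ => measurableSet_window_fiber _ _

theorem measureReal_window_eq_sum_cons (ν : Measure (ℤ → E)) [IsProbabilityMeasure ν] (j : ℤ)
    {n : ℕ} (u : Fin n → E) :
    ν.real (window (j + 1) n ⁻¹' {u}) =
      ∑ e, ν.real (window j (n + 1) ⁻¹' {Fin.cons (α := fun _ => E) e u}) := by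
  rw [← measureReal_biUnion_finset]
  · congr 1
    ext σ
    simp only [mem_preimage, mem_singleton_iff, Finset.mem_univ, iUnion_true, mem_iUnion,
      window_succ_eq_cons, Fin.cons_inj]
    simp
  · intro e _ e' _ hne
    refine Set.disjoint_left.2 fun σ h h' => hne ?_
    simp only [mem_preimage, mem_singleton_iff] at h h'
    exact (Fin.cons_inj.1 (h.symm.trans h')).1
  · exact fun e _ => measurableSet_window_fiber _ _

/-- A probability measure on the code space is determined by the laws of its blocks. -/
theorem ext_of_window {ν ν' : Measure (ℤ → E)} [IsProbabilityMeasure ν] [IsProbabilityMeasure ν']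
    (h : ∀ j n (u : Fin n → E), ν.real (window j n ⁻¹' {u}) = ν'.real (window j n ⁻¹' {u})) :
    ν = ν' := by
  refine ext_of_generate_finite (measurableCylinders fun _ : ℤ => E)
    generateFrom_measurableCylinders.symm isPiSystem_measurableCylinders ?_ (by simp)
  intro A hA
  obtain ⟨m, hm⟩ := exists_window_of_mem_measurableCylinders hA
  set Z : (ℤ → E) → (Fin (2 * m + 1) → E) := window (-(m : ℤ)) (2 * m + 1) with hZ
  have hZm : Measurable Z := measurable_window _ _
  have hmap : ν.map Z = ν'.map Z := by
    refine Measure.ext_of_singleton fun u => ?_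
    rw [Measure.map_apply hZm (measurableSet_singleton u),
      Measure.map_apply hZm (measurableSet_singleton u)]
    exact (measureReal_eq_measureReal_iff).1 (h _ _ u)
  have hAZ : A = Z ⁻¹' (Z '' A) := by
    refine subset_antisymm (subset_preimage_image _ _) ?_
    rintro σ ⟨τ, hτ, hστ⟩
    exact (hm m le_rfl _ _ hστ).1 hτ
  rw [hAZ, ← Measure.map_apply hZm (Set.toFinite _).measurableSet,
    ← Measure.map_apply hZm (Set.toFinite _).measurableSet, hmap]

theorem measurePreserving_shiftBy_of_window {ν : Measure (ℤ → E)} [IsProbabilityMeasure ν]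
    (h : ∀ j j' n (u : Fin n → E), ν.real (window j n ⁻¹' {u}) = ν.real (window j' n ⁻¹' {u}))
    (i : ℤ) : MeasurePreserving (shiftBy E i) ν ν := by
  refine ⟨measurable_shiftBy i, ?_⟩
  have : IsProbabilityMeasure (ν.map (shiftBy E i)) :=
    Measure.isProbabilityMeasure_map (measurable_shiftBy i).aemeasurable
  refine ext_of_window fun j n u => ?_
  rw [map_measureReal_apply (measurable_shiftBy i) (measurableSet_window_fiber _ _),
    h j (j + i) n u]
  congr 1
  ext σ
  simp only [mem_preimage, mem_singleton_iff]
  have : window j n (shiftBy E i σ) = window (j + i) n σ := by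
    funext k
    simp only [window, shiftBy]
    congr 1
    ring
  rw [this]

/-- Extension theorem: probability measures whose block laws are eventually given by `P` have a
limit with block laws `P`. -/
theorem exists_measure_of_eventually_window (νs : ℕ → ProbabilityMeasure (ℤ → E))
    (P : ∀ n, (Fin n → E) → ℝ)
    (h : ∀ j n u, ∀ᶠ k in atTop, (νs k : Measure (ℤ → E)).real (window j n ⁻¹' {u}) = P n u) :
    ∃ ν : ProbabilityMeasure (ℤ → E), ∀ j n u,
      (ν : Measure (ℤ → E)).real (window j n ⁻¹' {u}) = P n u := by
  let _ : TopologicalSpace E := ⊥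
  have _ : DiscreteTopology E := ⟨rfl⟩
  -- The space of probability measures on the compact code space is compact, so the sequence
  -- converges along an ultrafilter. Block events are clopen, so their measures converge too, and an
  -- eventually constant value is the limit.
  set U : Ultrafilter (ProbabilityMeasure (ℤ → E)) := (hyperfilter ℕ).map νs with hU
  have hlim : Tendsto νs (hyperfilter ℕ) (𝓝 U.lim) := U.le_nhds_lim
  refine ⟨U.lim, fun j n u => ?_⟩
  have hcont : Continuous (window (E := E) j n) :=
    continuous_pi fun _ => continuous_apply _
  have hclopen : IsClopen (window j n ⁻¹' {u}) := (isClopen_discrete _).preimage hcont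
  have h1 := ProbabilityMeasure.tendsto_measure_of_null_frontier_of_tendsto' hlim
    (E := window j n ⁻¹' {u}) (by rw [hclopen.frontier_eq]; simp)
  have h2 : Tendsto (fun k => (νs k : Measure (ℤ → E)) (window j n ⁻¹' {u})) (hyperfilter ℕ)
      (𝓝 ((U.lim : Measure (ℤ → E)) (window j n ⁻¹' {u}))) := h1
  have h3 := (ENNReal.tendsto_toReal (measure_ne_top _ _)).comp h2
  refine tendsto_nhds_unique h3 (tendsto_const_nhds.congr' ?_)
  filter_upwards [(h j n u).filter_mono Nat.hyperfilter_le_atTop] with k hk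
  exact hk.symm

end WindowLaw

namespace MarkovSystem

variable {V E K : Type*} [Fintype E] [MeasurableSpace E] [DiscreteMeasurableSpace E]
  [MeasurableSpace K]

/-- A probability measure charging finitely many sequences, with the block law on `[-n, n)` of the
stationary Markov system. -/
theorem exists_measure_window_centered (𝓜 : MarkovSystem V E K) (μ : Measure K)
    [IsProbabilityMeasure μ] (n : ℕ) :
    ∃ ν : ProbabilityMeasure (ℤ → E), ∀ u : Fin (2 * n) → E,
      (ν : Measure (ℤ → E)).real (window (-(n : ℤ)) (2 * n) ⁻¹' {u}) = 𝓜.blockProb μ u := by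
  classical
  obtain ⟨y⟩ : Nonempty K := nonempty_of_isProbabilityMeasure μ
  have hE : Nonempty E := by
    by_contra hE
    rw [not_nonempty_iff] at hE
    simpa using 𝓜.p_sum y
  obtain ⟨e₀⟩ := hE
  have hsurj : Function.Surjective (window (E := E) (-(n : ℤ)) (2 * n)) := by
    intro u
    refine ⟨fun k => if h : (k + n).toNat < 2 * n then u ⟨(k + n).toNat, h⟩ else e₀, ?_⟩
    funext i
    simp only [window]
    have : ((-(n : ℤ) + (i : ℕ) + n)).toNat = i := by omega
    simp
  choose ext hext using hsurj
  set ν : Measure (ℤ → E) :=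
    ∑ u : Fin (2 * n) → E, ENNReal.ofReal (𝓜.blockProb μ u) • Measure.dirac (ext u) with hν
  have hprob : IsProbabilityMeasure ν := by
    refine ⟨?_⟩
    rw [hν]
    simp only [Measure.coe_finsetSum, Finset.sum_apply, Measure.smul_apply, measure_univ,
      smul_eq_mul, mul_one]
    rw [← ENNReal.ofReal_sum_of_nonneg fun u _ => 𝓜.blockProb_nonneg μ u, 𝓜.sum_blockProb,
      ENNReal.ofReal_one]
  refine ⟨⟨ν, hprob⟩, fun u => ?_⟩
  change ν.real _ = _
  rw [measureReal_def, hν]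
  simp only [Measure.coe_finsetSum, Finset.sum_apply, Measure.smul_apply, smul_eq_mul]
  rw [Finset.sum_eq_single u]
  · rw [Measure.dirac_apply' _ (measurableSet_window_fiber _ _), indicator_of_mem (by simp [hext])]
    simp [𝓜.blockProb_nonneg μ u]
  · intro v _ hv
    rw [Measure.dirac_apply' _ (measurableSet_window_fiber _ _),
      indicator_of_notMem (by simpa [hext] using hv), mul_zero]
  · simp

/-- The generalized Markov measure: the law of the bi-infinite edge process of the stationary
Markov system. -/
theorem exists_markovMeasure (𝓜 : MarkovSystem V E K) {μ : Measure K} [IsProbabilityMeasure μ]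
    (h_inv : 𝓜.adjointOp μ = μ) :
    ∃ M : Measure (ℤ → E), IsProbabilityMeasure M ∧ (∀ i, MeasurePreserving (shiftBy E i) M M) ∧
      ∀ j n (u : Fin n → E), M.real (window j n ⁻¹' {u}) = 𝓜.blockProb μ u := by
  choose νs hνs using fun n => 𝓜.exists_measure_window_centered μ n
  -- Induction on the number d of letters missing from the full block on [-n, n). A shorter block is
  -- extended to the right while there is room, and otherwise to the left.
  have key : ∀ n d k : ℕ, ∀ j : ℤ, k + d = 2 * n → -(n : ℤ) ≤ j → j + k ≤ n →
      ∀ u : Fin k → E,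
        (νs n : Measure (ℤ → E)).real (window j k ⁻¹' {u}) = 𝓜.blockProb μ u := by
    intro n d
    induction d with
    | zero =>
      intro k j hk h1 h2 u
      obtain rfl : k = 2 * n := by omega
      obtain rfl : j = -(n : ℤ) := by omega
      exact hνs n u
    | succ d ih =>
      intro k j hk h1 h2 u
      by_cases hj : j + k < n
      · rw [measureReal_window_eq_sum_snoc, ← 𝓜.sum_blockProb_snoc μ u]
        exact Finset.sum_congr rfl fun e _ =>
          ih (k + 1) j (by omega) h1 (by push_cast; omega) _
      · obtain ⟨j', rfl⟩ : ∃ j', j = j' + 1 := ⟨j - 1, by ring⟩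
        rw [measureReal_window_eq_sum_cons, ← sum_blockProb_cons h_inv u]
        exact Finset.sum_congr rfl fun e _ =>
          ih (k + 1) j' (by omega) (by omega) (by push_cast; omega) _
  obtain ⟨ν, hν⟩ := exists_measure_of_eventually_window νs (fun n u => 𝓜.blockProb μ u) (by
    intro j k u
    filter_upwards [eventually_ge_atTop (j.natAbs + k)] with n hn
    exact key n (2 * n - k) k j (by omega) (by omega) (by omega) u)
  exact ⟨ν, inferInstance,
    measurePreserving_shiftBy_of_window fun j j' n u => by rw [hν, hν], hν⟩

end MarkovSystem

/-! ### The coding map -/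

theorem codeShift_zpow (E : Type*) (j : ℤ) (σ : ℤ → E) :
    (codeShift E ^ j : Equiv.Perm (ℤ → E)) σ = shiftBy E j σ := by
  induction j generalizing σ with
  | zero =>
    funext k
    simp [shiftBy]
  | succ n ih =>
    rw [zpow_add_one, Equiv.Perm.mul_apply, ih]
    funext k
    simp only [shiftBy, codeShift, Equiv.coe_fn_mk]
    congr 1
    ring
  | pred n ih =>
    rw [zpow_sub_one, Equiv.Perm.mul_apply, ih]
    funext k
    change σ (k + -(n : ℤ) - 1) = σ (k + (-(n : ℤ) - 1))
    congr 1
    ring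

namespace MarkovSystem

section Coding

variable {V E K : Type*} [Fintype E] [MeasurableSpace K] (𝓜 : MarkovSystem V E K)

theorem backComp_eq_wordMap (σ : ℤ → E) (n : ℕ) (y : K) :
    𝓜.backComp σ n y = 𝓜.wordMap (window (-(n : ℤ)) (n + 1) σ) y := by
  induction n generalizing y with
  | zero => simp [backComp, wordMap, window]
  | succ n ih =>
    have h1 : -((n + 1 : ℕ) : ℤ) = -((n : ℤ) + 1) := by push_cast; ring
    have h2 : -((n : ℤ) + 1) + 1 = -(n : ℤ) := by ring
    rw [window_succ_eq_cons, wordMap_cons, h1, h2]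
    exact ih _

/-- The end point of the word `u` started at the reference point of its initial vertex. -/
def wordEnd (x : V → K) {n : ℕ} (u : Fin (n + 1) → E) : K := 𝓜.wordMap u (x (𝓜.ini (u 0)))

theorem codingApprox_eq_wordEnd (x : V → K) (σ : ℤ → E) (n : ℕ) :
    𝓜.codingApprox x σ n = 𝓜.wordEnd x (window (-(n : ℤ)) (n + 1) σ) := by
  rw [codingApprox, backComp_eq_wordMap]
  simp [wordEnd, window]

theorem measurable_codingApprox [MeasurableSpace E] [DiscreteMeasurableSpace E] (x : V → K)
    (n : ℕ) : Measurable fun σ => 𝓜.codingApprox x σ n := by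
  simp_rw [codingApprox_eq_wordEnd]
  exact measurable_of_comp_finite (measurable_window _ _) (𝓜.wordEnd x)

theorem measurableSet_pathSpace [MeasurableSpace E] [DiscreteMeasurableSpace E] :
    MeasurableSet 𝓜.pathSpace := by
  have : 𝓜.pathSpace =
      ⋂ j : ℤ, (fun σ : ℤ → E => (σ j, σ (j + 1))) ⁻¹' {p | 𝓜.ter p.1 = 𝓜.ini p.2} := by
    ext σ
    simp [pathSpace]
  rw [this]
  exact MeasurableSet.iInter fun j =>
    ((measurable_pi_apply j).prodMk (measurable_pi_apply (j + 1))) (Set.toFinite _).measurableSet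

theorem mem_codingCore_iff [TopologicalSpace K] {x : V → K} {σ : ℤ → E} :
    σ ∈ 𝓜.codingCore x ↔ ∀ j : ℤ, shiftBy E j σ ∈ 𝓜.codingDomain x := by
  simp only [codingCore, mem_iInter]
  constructor
  · intro h j
    obtain ⟨τ, hτ, rfl⟩ := h (-j)
    rw [codeShift_zpow]
    convert hτ
    funext k
    simp [shiftBy]
  · intro h j
    refine ⟨shiftBy E (-j) σ, h (-j), ?_⟩
    rw [codeShift_zpow]
    funext k
    simp [shiftBy]

theorem tendsto_codingMap [TopologicalSpace K] {x : V → K} {σ : ℤ → E}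
    (h : σ ∈ 𝓜.codingDomain x) :
    Tendsto (𝓜.codingApprox x σ) atTop (𝓝 (𝓜.codingMap x σ)) := by
  rw [codingMap, dif_pos h.2]
  exact h.2.choose_spec

theorem codingCore_subset_codingDomain [TopologicalSpace K] {x : V → K} :
    𝓜.codingCore x ⊆ 𝓜.codingDomain x := by
  intro σ hσ
  have := (𝓜.mem_codingCore_iff).1 hσ 0
  convert this
  funext k
  simp [shiftBy]

theorem codeShift_mem_codingCore [TopologicalSpace K] {x : V → K} {σ : ℤ → E}
    (h : σ ∈ 𝓜.codingCore x) : codeShift E σ ∈ 𝓜.codingCore x := by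
  rw [mem_codingCore_iff] at h ⊢
  intro j
  convert h (j + 1) using 1
  funext k
  simp only [shiftBy, codeShift, Equiv.coe_fn_mk]
  congr 1
  ring

/-- The path condition at consecutive letters passes the point from cell to cell; the last one is
the initial cell of σ_1, where p_{σ_1} ≥ δ will apply. -/
theorem codingApprox_mem {x : V → K} (hx : ∀ v, x v ∈ 𝓜.vertexSet v) {σ : ℤ → E}
    (h : σ ∈ 𝓜.pathSpace) (n : ℕ) :
    𝓜.codingApprox x σ n ∈ 𝓜.vertexSet (𝓜.ini (σ 1)) := by
  have key : ∀ n : ℕ, ∀ y ∈ 𝓜.vertexSet (𝓜.ini (σ (-(n : ℤ)))),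
      𝓜.backComp σ n y ∈ 𝓜.vertexSet (𝓜.ini (σ 1)) := by
    intro n
    induction n with
    | zero =>
      intro y hy
      have h1 := 𝓜.w_mapsTo _ hy
      rw [h] at h1
      simpa [backComp] using h1
    | succ n ih =>
      intro y hy
      have h0 : -((n + 1 : ℕ) : ℤ) = -((n : ℤ) + 1) := by push_cast; ring
      rw [h0] at hy
      have h1 := 𝓜.w_mapsTo _ hy
      rw [h, show -((n : ℤ) + 1) + 1 = -(n : ℤ) by ring] at h1
      exact ih _ h1
  exact key n _ (hx _)

theorem isClosed_vertexSet [TopologicalSpace K] (h_open : ∀ v, IsOpen (𝓜.vertexSet v)) (v : V) :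
    IsClosed (𝓜.vertexSet v) := by
  have : (𝓜.vertexSet v)ᶜ = ⋃ v' ∈ {v' | v' ≠ v}, 𝓜.vertexSet v' := by
    ext y
    simp only [mem_compl_iff, mem_ofPred_eq, mem_iUnion, exists_prop]
    constructor
    · intro hy
      obtain ⟨v', hv'⟩ := 𝓜.exists_mem_vertexSet y
      exact ⟨v', fun he => hy (he ▸ hv'), hv'⟩
    · rintro ⟨v', hne, hv'⟩ hy
      exact hne (𝓜.eq_of_mem_vertexSet hv' hy)
  rw [← isOpen_compl_iff, this]
  exact isOpen_biUnion fun v' _ => h_open v'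

/-- Cells are closed because they are open and partition the space, so the limit stays in the cell
of the approximants. -/
theorem codingMap_mem [TopologicalSpace K] (h_open : ∀ v, IsOpen (𝓜.vertexSet v)) {x : V → K}
    (hx : ∀ v, x v ∈ 𝓜.vertexSet v) {σ : ℤ → E} (h : σ ∈ 𝓜.codingDomain x) :
    𝓜.codingMap x σ ∈ 𝓜.vertexSet (𝓜.ini (σ 1)) :=
  (𝓜.isClosed_vertexSet h_open _).mem_of_tendsto (𝓜.tendsto_codingMap h)
    (Eventually.of_forall fun n => 𝓜.codingApprox_mem hx h.1 n)

/-- The shift moves σ_1 to position 0, so reaching the same earliest letter takes one more step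
back; the starting reference point is the same. -/
theorem codingApprox_codeShift (x : V → K) (σ : ℤ → E) (n : ℕ) :
    𝓜.codingApprox x (codeShift E σ) (n + 1) = 𝓜.w (σ 1) (𝓜.codingApprox x σ n) := by
  rw [codingApprox_eq_wordEnd, codingApprox_eq_wordEnd]
  have : window (-((n + 1 : ℕ) : ℤ)) (n + 1 + 1) (codeShift E σ) =
      Fin.snoc (α := fun _ => E) (window (-(n : ℤ)) (n + 1) σ) (σ 1) := by
    have hw : window (-((n + 1 : ℕ) : ℤ)) (n + 1 + 1) (codeShift E σ) =
        window (-(n : ℤ)) (n + 1 + 1) σ := by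
      funext i
      simp only [window, codeShift, Equiv.coe_fn_mk]
      congr 1
      push_cast
      ring
    rw [hw, window_succ_eq_snoc]
    congr 2
    push_cast
    ring
  rw [this, wordEnd, wordMap_snoc, wordEnd]
  congr 3

end Coding

/-! ### Regularity of the maps and equivariance of the coding map -/

section Metric

variable {V E K : Type*} [Fintype E] [MetricSpace K] [MeasurableSpace K]
  {𝓜 : MarkovSystem V E K}

/-- The maps are Lipschitz on the vertex sets where they are chosen with positive probability. -/
theorem mul_dist_w_le {a : ℝ} (h_contr : 𝓜.IsContractive a) {δ : ℝ}
    (h_pos : ∀ e, ∀ y ∈ 𝓜.vertexSet (𝓜.ini e), δ ≤ 𝓜.p e y) (e : E) {y z : K}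
    (hy : y ∈ 𝓜.vertexSet (𝓜.ini e)) (hz : z ∈ 𝓜.vertexSet (𝓜.ini e)) :
    δ * dist (𝓜.w e y) (𝓜.w e z) ≤ a * dist y z := by
  refine le_trans ?_ (h_contr.2.2 _ y hy z hz)
  refine (mul_le_mul_of_nonneg_right (h_pos e y hy) dist_nonneg).trans ?_
  exact Finset.single_le_sum (f := fun e => 𝓜.p e y * dist (𝓜.w e y) (𝓜.w e z))
    (fun e _ => mul_nonneg (𝓜.p_nonneg e y) dist_nonneg) (Finset.mem_univ e)

/-- Average contraction controls an individual map because its weight is at least δ; this gives the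
Lipschitz constant a/δ on the initial cell. -/
theorem continuousOn_w {a : ℝ} (h_contr : 𝓜.IsContractive a) {δ : ℝ} (hδ : 0 < δ)
    (h_pos : ∀ e, ∀ y ∈ 𝓜.vertexSet (𝓜.ini e), δ ≤ 𝓜.p e y) (e : E) :
    ContinuousOn (𝓜.w e) (𝓜.vertexSet (𝓜.ini e)) := by
  have : LipschitzOnWith (Real.toNNReal (a / δ)) (𝓜.w e) (𝓜.vertexSet (𝓜.ini e)) := by
    refine LipschitzOnWith.of_dist_le_mul fun y hy z hz => ?_
    rw [Real.coe_toNNReal _ (div_nonneg h_contr.1.le hδ.le), div_mul_eq_mul_div, le_div_iff₀ hδ,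
      mul_comm]
    exact mul_dist_w_le h_contr h_pos e hy hz
  exact this.continuousOn

theorem codingMap_codeShift {a : ℝ} (h_contr : 𝓜.IsContractive a) {δ : ℝ} (hδ : 0 < δ)
    (h_pos : ∀ e, ∀ y ∈ 𝓜.vertexSet (𝓜.ini e), δ ≤ 𝓜.p e y)
    (h_open : ∀ v, IsOpen (𝓜.vertexSet v)) {x : V → K} (hx : ∀ v, x v ∈ 𝓜.vertexSet v)
    {σ : ℤ → E} (h : σ ∈ 𝓜.codingCore x) :
    𝓜.codingMap x (codeShift E σ) = 𝓜.w (σ 1) (𝓜.codingMap x σ) := by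
  have hD := 𝓜.codingCore_subset_codingDomain h
  have h1 := (tendsto_add_atTop_iff_nat 1).2 (𝓜.tendsto_codingMap
    (𝓜.codingCore_subset_codingDomain (𝓜.codeShift_mem_codingCore h)))
  simp_rw [codingApprox_codeShift] at h1
  have h2 : ContinuousAt (𝓜.w (σ 1)) (𝓜.codingMap x σ) :=
    (continuousOn_w h_contr hδ h_pos (σ 1)).continuousAt
      ((h_open _).mem_nhds (𝓜.codingMap_mem h_open hx hD))
  exact tendsto_nhds_unique h1 (h2.tendsto.comp (𝓜.tendsto_codingMap hD))

/-- The Markov operator preserves continuity (Feller property). -/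
theorem continuous_markovOp {a : ℝ} (h_contr : 𝓜.IsContractive a) {δ : ℝ} (hδ : 0 < δ)
    (h_pos : ∀ e, ∀ y ∈ 𝓜.vertexSet (𝓜.ini e), δ ≤ 𝓜.p e y)
    (h_open : ∀ v, IsOpen (𝓜.vertexSet v))
    (h_unif : ∀ e, UniformContinuousOn (𝓜.p e) (𝓜.vertexSet (𝓜.ini e))) {f : K → ℝ}
    (hf : Continuous f) : Continuous (𝓜.markovOp f) := by
  refine continuous_finsetSum _ fun e _ => continuous_iff_continuousAt.2 fun y => ?_
  by_cases hy : y ∈ 𝓜.vertexSet (𝓜.ini e)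
  · have hn := (h_open _).mem_nhds hy
    exact ((h_unif e).continuousOn.continuousAt hn).mul
      (hf.continuousAt.comp ((continuousOn_w h_contr hδ h_pos e).continuousAt hn))
  · have hn := (𝓜.isClosed_vertexSet h_open (𝓜.ini e)).isOpen_compl.mem_nhds hy
    refine ContinuousAt.congr (f := fun _ => (0 : ℝ)) continuousAt_const ?_
    filter_upwards [hn] with z hz
    rw [𝓜.p_zero e z hz, zero_mul]

theorem measurableSet_codingCore [ProperSpace K] [BorelSpace K] [MeasurableSpace E]
    [DiscreteMeasurableSpace E] (x : V → K) : MeasurableSet (𝓜.codingCore x) := by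
  have h1 : MeasurableSet (𝓜.codingDomain x) :=
    𝓜.measurableSet_pathSpace.inter
      (measurableSet_exists_tendsto fun n => 𝓜.measurable_codingApprox x n)
  have h2 : 𝓜.codingCore x = ⋂ j : ℤ, shiftBy E j ⁻¹' 𝓜.codingDomain x := by
    ext σ
    simp [mem_codingCore_iff]
  rw [h2]
  exact MeasurableSet.iInter fun j => measurable_shiftBy j h1

end Metric

/-! ### First moments and the domain of the coding map -/

section Drift

variable {V E K : Type*} [Fintype E] [MeasurableSpace K] {𝓜 : MarkovSystem V E K}

/-- A Foster-Lyapunov criterion: a drift condition bounds the invariant mean of a function. -/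
theorem integrable_of_drift {μ : Measure K} [IsProbabilityMeasure μ] (h_inv : 𝓜.adjointOp μ = μ)
    {f : K → ℝ} (hf : Measurable f) (hf0 : ∀ y, 0 ≤ f y) {a b : ℝ} (ha0 : 0 ≤ a) (ha : a < 1)
    (hb : 0 ≤ b) (hdrift : ∀ y, 𝓜.markovOp f y ≤ a * f y + b) : Integrable f μ := by
  -- The function f is not yet known to be integrable, so the drift inequality is truncated at n.
  -- Since U(min(f, n)) ≤ min(af + b, n), invariance gives ∫ g_n dμ ≤ b. As g_n ≥ 0 and g_n → (1 -
  -- a) f, Fatou's lemma concludes.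
  set g : ℕ → K → ℝ := fun n y => min (f y) n - min (a * f y + b) n + b with hg
  have hm1 : ∀ n : ℕ, Measurable fun y => min (f y) (n : ℝ) := fun n => hf.min measurable_const
  have hm2 : ∀ n : ℕ, Measurable fun y => min (a * f y + b) (n : ℝ) := fun n =>
    ((hf.const_mul a).add_const b).min measurable_const
  have hb1 : ∀ (n : ℕ) y, |min (f y) (n : ℝ)| ≤ n := fun n y => by
    rw [abs_of_nonneg (le_min (hf0 y) n.cast_nonneg)]; exact min_le_right _ _
  have hg0 : ∀ y, 0 ≤ a * f y + b := fun y => add_nonneg (mul_nonneg ha0 (hf0 y)) hb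
  have hb2 : ∀ (n : ℕ) y, |min (a * f y + b) (n : ℝ)| ≤ n := fun n y => by
    rw [abs_of_nonneg (le_min (hg0 y) n.cast_nonneg)]; exact min_le_right _ _
  have hi1 : ∀ n : ℕ, Integrable (fun y => min (f y) (n : ℝ)) μ := fun n =>
    integrable_of_abs_le (hm1 n) (hb1 n)
  have hi2 : ∀ n : ℕ, Integrable (fun y => min (a * f y + b) (n : ℝ)) μ := fun n =>
    integrable_of_abs_le (hm2 n) (hb2 n)
  have hgm : ∀ n, Measurable (g n) := fun n => ((hm1 n).sub (hm2 n)).add_const b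
  have hgi : ∀ n, Integrable (g n) μ := fun n => ((hi1 n).sub (hi2 n)).add (integrable_const b)
  have hgnn : ∀ n y, 0 ≤ g n y := by
    intro n y
    simp only [hg]
    have := hf0 y
    rcases le_total (f y) n with h | h
    · rw [min_eq_left h]
      have := min_le_left (a * f y + b) (n : ℝ)
      nlinarith
    · rw [min_eq_right h]
      have := min_le_right (a * f y + b) (n : ℝ)
      linarith
  have hgint : ∀ n, ∫ y, g n y ∂μ ≤ b := by
    intro n
    have h1 : ∫ y, min (f y) (n : ℝ) ∂μ ≤ ∫ y, min (a * f y + b) (n : ℝ) ∂μ := by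
      rw [← integral_markovOp h_inv (hm1 n) (hb1 n)]
      refine integral_mono (integrable_of_abs_le (𝓜.measurable_markovOp (hm1 n))
        (𝓜.abs_markovOp_le (hb1 n))) (hi2 n) fun y => le_min ?_ ?_
      · refine le_trans ?_ (hdrift y)
        exact Finset.sum_le_sum fun e _ =>
          mul_le_mul_of_nonneg_left (min_le_left _ _) (𝓜.p_nonneg e y)
      · exact (le_abs_self _).trans (𝓜.abs_markovOp_le (hb1 n) y)
    have h2 : ∫ y, g n y ∂μ =
        (∫ y, min (f y) (n : ℝ) ∂μ) - (∫ y, min (a * f y + b) (n : ℝ) ∂μ) + b := by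
      have h3 : Integrable (fun y => min (f y) (n : ℝ) - min (a * f y + b) (n : ℝ)) μ :=
        (hi1 n).sub (hi2 n)
      simp only [hg]
      rw [integral_add h3 (integrable_const b), integral_sub (hi1 n) (hi2 n)]
      simp
    linarith
  have hlim : ∀ y, Tendsto (fun n => ENNReal.ofReal (g n y)) atTop
      (𝓝 (ENNReal.ofReal ((1 - a) * f y))) := by
    intro y
    refine tendsto_const_nhds.congr' ?_
    obtain ⟨N, hN⟩ := exists_nat_ge (max (f y) (a * f y + b))
    filter_upwards [eventually_ge_atTop N] with n hn
    have hn' : (N : ℝ) ≤ n := by exact_mod_cast hn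
    simp only [hg]
    rw [min_eq_left ((le_max_left _ _).trans (hN.trans hn')),
      min_eq_left ((le_max_right _ _).trans (hN.trans hn'))]
    congr 1
    ring
  have hfatou : ∫⁻ y, ENNReal.ofReal ((1 - a) * f y) ∂μ ≤ ENNReal.ofReal b := by
    calc ∫⁻ y, ENNReal.ofReal ((1 - a) * f y) ∂μ
        = ∫⁻ y, liminf (fun n => ENNReal.ofReal (g n y)) atTop ∂μ :=
          lintegral_congr fun y => (hlim y).liminf_eq.symm
      _ ≤ liminf (fun n => ∫⁻ y, ENNReal.ofReal (g n y) ∂μ) atTop :=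
          lintegral_liminf_le fun n => (hgm n).ennreal_ofReal
      _ ≤ ENNReal.ofReal b := by
          refine liminf_le_of_le (by isBoundedDefault) fun c hc => ?_
          obtain ⟨n, hn⟩ := hc.exists
          refine hn.trans ?_
          rw [← ofReal_integral_eq_lintegral_ofReal (hgi n) (ae_of_all _ (hgnn n))]
          exact ENNReal.ofReal_le_ofReal (hgint n)
  have h1 : Integrable (fun y => (1 - a) * f y) μ := by
    refine ⟨(hf.const_mul _).aestronglyMeasurable, ?_⟩
    rw [hasFiniteIntegral_iff_ofReal (ae_of_all _ fun y =>
      mul_nonneg (by linarith) (hf0 y))]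
    exact hfatou.trans_lt ENNReal.ofReal_lt_top
  refine (h1.const_mul (1 - a)⁻¹).congr (ae_of_all _ fun y => ?_)
  simp only
  rw [inv_mul_cancel_left₀ (by linarith)]

theorem ini_of_wordProb_ne_zero {n : ℕ} {u : Fin (n + 1) → E} {y : K} (hu : 𝓜.wordProb u y ≠ 0)
    {v : V} (hv : y ∈ 𝓜.vertexSet v) : 𝓜.ini (u 0) = v :=
  𝓜.eq_of_mem_vertexSet (𝓜.mem_of_p_ne_zero (left_ne_zero_of_mul hu)) hv

end Drift

/-- The distance moved by the reference points. -/
noncomputable def driftConst {V E K : Type*} [Fintype E] [MetricSpace K]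
    [MeasurableSpace K] (𝓜 : MarkovSystem V E K) (x : V → K) : ℝ :=
  ∑ e, dist (𝓜.w e (x (𝓜.ini e))) (x (𝓜.ter e))

theorem driftConst_nonneg {V E K : Type*} [Fintype E] [MetricSpace K] [MeasurableSpace K]
    {𝓜 : MarkovSystem V E K} (x : V → K) : 0 ≤ 𝓜.driftConst x :=
  Finset.sum_nonneg fun _ _ => dist_nonneg

/-! ### Distance to the reference points -/

section Moments

variable {V E K : Type*} [Fintype V] [Fintype E] [MetricSpace K] [MeasurableSpace K]
  {𝓜 : MarkovSystem V E K}

/-- The distance to the reference point of the vertex set containing the given point. -/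
noncomputable def cellDist (𝓜 : MarkovSystem V E K) (x : V → K) (y : K) : ℝ :=
  ∑ v, (𝓜.vertexSet v).indicator (fun y => dist y (x v)) y

theorem cellDist_eq (x : V → K) {v : V} {y : K} (hy : y ∈ 𝓜.vertexSet v) :
    𝓜.cellDist x y = dist y (x v) := by
  rw [cellDist, Finset.sum_eq_single v]
  · rw [indicator_of_mem hy]
  · intro v' _ hne
    exact indicator_of_notMem (fun h => hne (𝓜.eq_of_mem_vertexSet h hy)) _
  · simp

theorem cellDist_nonneg (x : V → K) (y : K) : 0 ≤ 𝓜.cellDist x y := by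
  obtain ⟨v, hv⟩ := 𝓜.exists_mem_vertexSet y
  rw [cellDist_eq x hv]
  exact dist_nonneg

theorem measurable_cellDist [OpensMeasurableSpace K] (x : V → K) :
    Measurable (𝓜.cellDist x) :=
  Finset.measurable_sum _ fun v _ =>
    ((continuous_id.dist continuous_const).measurable).indicator (𝓜.vertexSet_measurable v)

theorem markovOp_cellDist_le {a : ℝ} (h_contr : 𝓜.IsContractive a) {x : V → K}
    (hx : ∀ v, x v ∈ 𝓜.vertexSet v) (y : K) :
    𝓜.markovOp (𝓜.cellDist x) y ≤ a * 𝓜.cellDist x y + 𝓜.driftConst x := by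
  obtain ⟨v, hv⟩ := 𝓜.exists_mem_vertexSet y
  calc 𝓜.markovOp (𝓜.cellDist x) y
      ≤ ∑ e, (𝓜.p e y * dist (𝓜.w e y) (𝓜.w e (x v)) + 𝓜.p e y * 𝓜.driftConst x) := by
        refine Finset.sum_le_sum fun e _ => ?_
        by_cases he : 𝓜.p e y = 0
        · simp [he]
        · have hi := 𝓜.mem_of_p_ne_zero he
          obtain rfl := 𝓜.eq_of_mem_vertexSet hv hi
          rw [← mul_add, cellDist_eq x (𝓜.w_mapsTo e hi)]
          refine mul_le_mul_of_nonneg_left ((dist_triangle _ (𝓜.w e (x (𝓜.ini e))) _).trans ?_)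
            (𝓜.p_nonneg e y)
          exact add_le_add le_rfl (Finset.single_le_sum
            (f := fun e => dist (𝓜.w e (x (𝓜.ini e))) (x (𝓜.ter e)))
            (fun _ _ => dist_nonneg) (Finset.mem_univ e))
    _ = (∑ e, 𝓜.p e y * dist (𝓜.w e y) (𝓜.w e (x v))) + 𝓜.driftConst x := by
        rw [Finset.sum_add_distrib, ← Finset.sum_mul, 𝓜.p_sum, one_mul]
    _ ≤ a * 𝓜.cellDist x y + 𝓜.driftConst x := by
        rw [cellDist_eq x hv]
        exact add_le_add (h_contr.2.2 v y hv _ (hx v)) le_rfl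

theorem integrable_cellDist [OpensMeasurableSpace K] {a : ℝ} (h_contr : 𝓜.IsContractive a)
    {x : V → K} (hx : ∀ v, x v ∈ 𝓜.vertexSet v) {μ : Measure K} [IsProbabilityMeasure μ]
    (h_inv : 𝓜.adjointOp μ = μ) : Integrable (𝓜.cellDist x) μ :=
  integrable_of_drift h_inv (measurable_cellDist x) (cellDist_nonneg x) h_contr.1.le h_contr.2.1
    (driftConst_nonneg x) (markovOp_cellDist_le h_contr hx)

theorem sum_wordProb_dist_wordEnd_le {a : ℝ} (h_contr : 𝓜.IsContractive a) {x : V → K}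
    (hx : ∀ v, x v ∈ 𝓜.vertexSet v) (n : ℕ) (y : K) :
    ∑ u : Fin (n + 1) → E, 𝓜.wordProb u y * dist (𝓜.wordMap u y) (𝓜.wordEnd x u) ≤
      a ^ (n + 1) * 𝓜.cellDist x y := by
  obtain ⟨v, hv⟩ := 𝓜.exists_mem_vertexSet y
  rw [cellDist_eq x hv]
  refine le_trans (le_of_eq ?_) (sum_wordProb_dist_le h_contr (n + 1) ⟨v, hv, hx v⟩)
  refine Finset.sum_congr rfl fun u _ => ?_
  by_cases hu : 𝓜.wordProb u y = 0
  · simp [hu]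
  · rw [wordEnd, ini_of_wordProb_ne_zero hu hv]

/-- Dropping the earliest letter restarts the word at another reference point. Both end points are
compared with that of the true trajectory from y, which is close to each on average. -/
theorem sum_wordProb_dist_wordEnd_tail_le {a : ℝ} (h_contr : 𝓜.IsContractive a) {x : V → K}
    (hx : ∀ v, x v ∈ 𝓜.vertexSet v) (n : ℕ) (y : K) :
    ∑ u : Fin (n + 2) → E,
        𝓜.wordProb u y * dist (𝓜.wordEnd x (Fin.tail u)) (𝓜.wordEnd x u) ≤
      a ^ (n + 1) * (2 * 𝓜.cellDist x y + 𝓜.driftConst x) := by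
  have ha := pow_nonneg h_contr.1.le (n + 1)
  have hc := cellDist_nonneg (𝓜 := 𝓜) x y
  calc _ ≤ ∑ u : Fin (n + 2) → E,
        (𝓜.wordProb u y * dist (𝓜.wordMap u y) (𝓜.wordEnd x (Fin.tail u)) +
          𝓜.wordProb u y * dist (𝓜.wordMap u y) (𝓜.wordEnd x u)) := by
        refine Finset.sum_le_sum fun u _ => ?_
        rw [← mul_add]
        exact mul_le_mul_of_nonneg_left (dist_triangle_left _ _ _) (𝓜.wordProb_nonneg u y)
    _ = (∑ e, 𝓜.p e y * ∑ u : Fin (n + 1) → E, 𝓜.wordProb u (𝓜.w e y) *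
          dist (𝓜.wordMap u (𝓜.w e y)) (𝓜.wordEnd x u)) +
        ∑ u : Fin (n + 2) → E, 𝓜.wordProb u y * dist (𝓜.wordMap u y) (𝓜.wordEnd x u) := by
        rw [Finset.sum_add_distrib, sum_wordProb_succ]
        simp only [wordMap_cons, Fin.tail_cons]
    _ ≤ (∑ e, 𝓜.p e y * (a ^ (n + 1) * 𝓜.cellDist x (𝓜.w e y))) +
        a ^ (n + 1 + 1) * 𝓜.cellDist x y := by
        refine add_le_add (Finset.sum_le_sum fun e _ => mul_le_mul_of_nonneg_left
          (sum_wordProb_dist_wordEnd_le h_contr hx n _) (𝓜.p_nonneg e y))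
          (sum_wordProb_dist_wordEnd_le h_contr hx (n + 1) y)
    _ = a ^ (n + 1) * 𝓜.markovOp (𝓜.cellDist x) y + a ^ (n + 1) * (a * 𝓜.cellDist x y) := by
        rw [markovOp, Finset.mul_sum]
        congr 1
        · exact Finset.sum_congr rfl fun e _ => by ring
        · ring
    _ ≤ a ^ (n + 1) * (𝓜.cellDist x y + 𝓜.driftConst x) + a ^ (n + 1) * 𝓜.cellDist x y := by
        have h1 := markovOp_cellDist_le h_contr hx y
        have h2 : a * 𝓜.cellDist x y ≤ 𝓜.cellDist x y :=
          mul_le_of_le_one_left hc h_contr.2.1.le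
        refine add_le_add (mul_le_mul_of_nonneg_left (by linarith) ha)
          (mul_le_mul_of_nonneg_left h2 ha)
    _ = a ^ (n + 1) * (2 * 𝓜.cellDist x y + 𝓜.driftConst x) := by ring

end Moments

theorem integral_window {V E K : Type*} [Fintype E] [MeasurableSpace E] [DiscreteMeasurableSpace E]
    [MeasurableSpace K] {𝓜 : MarkovSystem V E K} {μ : Measure K} [IsProbabilityMeasure μ]
    {M : Measure (ℤ → E)} [IsProbabilityMeasure M]
    (hM : ∀ j n (u : Fin n → E), M.real (window j n ⁻¹' {u}) = 𝓜.blockProb μ u)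
    (j : ℤ) {n : ℕ} (φ : (Fin n → E) → ℝ) :
    ∫ σ, φ (window j n σ) ∂M = ∫ y, ∑ u, 𝓜.wordProb u y * φ u ∂μ := by
  rw [integral_comp_finite (measurable_window j n),
    integral_finsetSum _ fun u _ => (integrable_wordProb u).mul_const _]
  simp_rw [hM, integral_mul_const]
  rfl

/-- Almost every sequence shows only pairs of letters of positive probability, and a pair violating
the path condition has probability zero: w_e lands in the terminal cell of e, where the next p
vanishes. -/
theorem ae_mem_pathSpace {V E K : Type*} [Fintype E] [MeasurableSpace E] [MeasurableSpace K]
    {𝓜 : MarkovSystem V E K} {μ : Measure K} {M : Measure (ℤ → E)} [IsProbabilityMeasure M]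
    (hM : ∀ j n (u : Fin n → E), M.real (window j n ⁻¹' {u}) = 𝓜.blockProb μ u) :
    ∀ᵐ σ ∂M, σ ∈ 𝓜.pathSpace := by
  have h1 : ∀ᵐ σ ∂M, ∀ j : ℤ, 0 < M.real (window j 2 ⁻¹' {window j 2 σ}) :=
    ae_all_iff.2 fun j => ae_measureReal_fiber_pos
  filter_upwards [h1] with σ hσ j
  have h2 := hσ j
  rw [hM] at h2
  by_contra hne
  refine h2.ne' ?_
  rw [blockProb]
  refine integral_eq_zero_of_ae (ae_of_all _ fun y => ?_)
  simp only [wordProb, window, Pi.zero_apply, mul_one, Fin.tail]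
  by_contra h3
  have h4 := 𝓜.mem_of_p_ne_zero (left_ne_zero_of_mul h3)
  have h5 := 𝓜.mem_of_p_ne_zero (right_ne_zero_of_mul h3)
  have h6 := 𝓜.eq_of_mem_vertexSet (𝓜.w_mapsTo _ h4) h5
  simp at h6
  exact hne h6

/-! ### Almost sure convergence under the generalized Markov measure -/

section MarkovMeasure

variable {V E K : Type*} [Fintype V] [Fintype E] [MeasurableSpace E] [DiscreteMeasurableSpace E]
  [MetricSpace K] [MeasurableSpace K] [BorelSpace K]
  {𝓜 : MarkovSystem V E K} {μ : Measure K} [IsProbabilityMeasure μ]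
  {M : Measure (ℤ → E)} [IsProbabilityMeasure M]

theorem integral_dist_codingApprox_le {a : ℝ} (h_contr : 𝓜.IsContractive a) {x : V → K}
    (hx : ∀ v, x v ∈ 𝓜.vertexSet v) (h_inv : 𝓜.adjointOp μ = μ)
    (hM : ∀ j n (u : Fin n → E), M.real (window j n ⁻¹' {u}) = 𝓜.blockProb μ u) (n : ℕ) :
    ∫ σ, dist (𝓜.codingApprox x σ n) (𝓜.codingApprox x σ (n + 1)) ∂M ≤
      a ^ (n + 1) * ∫ y, (2 * 𝓜.cellDist x y + 𝓜.driftConst x) ∂μ := by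
  have h1 : ∀ σ : ℤ → E, dist (𝓜.codingApprox x σ n) (𝓜.codingApprox x σ (n + 1)) =
      dist (𝓜.wordEnd x (Fin.tail (window (-((n + 1 : ℕ) : ℤ)) (n + 2) σ)))
        (𝓜.wordEnd x (window (-((n + 1 : ℕ) : ℤ)) (n + 2) σ)) := by
    intro σ
    rw [codingApprox_eq_wordEnd, codingApprox_eq_wordEnd]
    congr 2
    rw [window_succ_eq_cons (-((n + 1 : ℕ) : ℤ)) (n + 1), Fin.tail_cons]
    congr 1
    push_cast
    ring
  simp_rw [h1]
  rw [integral_window hM (-((n + 1 : ℕ) : ℤ)) (n := n + 2)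
    fun u => dist (𝓜.wordEnd x (Fin.tail u)) (𝓜.wordEnd x u), ← integral_const_mul]
  refine integral_mono (integrable_finsetSum _ fun u _ => (integrable_wordProb u).mul_const _)
    ((((integrable_cellDist h_contr hx h_inv).const_mul 2).add (integrable_const _)).const_mul _)
    fun y => sum_wordProb_dist_wordEnd_tail_le h_contr hx n y

/-- Expected successive distances decay geometrically, so almost surely their sum is finite and the
approximants are Cauchy. -/
theorem ae_exists_tendsto_codingApprox [ProperSpace K] {a : ℝ} (h_contr : 𝓜.IsContractive a) {x : V → K}
    (hx : ∀ v, x v ∈ 𝓜.vertexSet v) (h_inv : 𝓜.adjointOp μ = μ)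
    (hM : ∀ j n (u : Fin n → E), M.real (window j n ⁻¹' {u}) = 𝓜.blockProb μ u) :
    ∀ᵐ σ ∂M, ∃ z, Tendsto (𝓜.codingApprox x σ) atTop (𝓝 z) := by
  set C : ℝ := ∫ y, (2 * 𝓜.cellDist x y + 𝓜.driftConst x) ∂μ with hC
  have hmeas : ∀ n, Measurable fun σ =>
      edist (𝓜.codingApprox x σ n) (𝓜.codingApprox x σ (n + 1)) := fun n =>
    (𝓜.measurable_codingApprox x n).edist (𝓜.measurable_codingApprox x (n + 1))
  have hint : ∀ n, Integrable (fun σ =>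
      dist (𝓜.codingApprox x σ n) (𝓜.codingApprox x σ (n + 1))) M := by
    intro n
    refine integrable_of_factors (measurable_window (-((n + 1 : ℕ) : ℤ)) (n + 2)) _ ?_
    intro σ τ h
    rw [window_eq_iff] at h
    rw [codingApprox_eq_wordEnd, codingApprox_eq_wordEnd, codingApprox_eq_wordEnd,
      codingApprox_eq_wordEnd]
    rw [(window_eq_iff (j := -(n : ℤ)) (n := n + 1)).2 fun i h1 h2 =>
      h i (by push_cast; omega) (by push_cast at h2 ⊢; omega),
      (window_eq_iff (j := -((n + 1 : ℕ) : ℤ)) (n := n + 1 + 1)).2 fun i h1 h2 =>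
      h i h1 (by push_cast at h2 ⊢; omega)]
  have hfin : ∫⁻ σ, ∑' n, edist (𝓜.codingApprox x σ n) (𝓜.codingApprox x σ (n + 1)) ∂M ≠ ⊤ := by
    rw [lintegral_tsum fun n => (hmeas n).aemeasurable]
    have hs : Summable fun n : ℕ => a ^ (n + 1) * C :=
      ((summable_nat_add_iff 1).2
        (summable_geometric_of_lt_one h_contr.1.le h_contr.2.1)).mul_right C
    refine ne_top_of_le_ne_top hs.tsum_ofReal_ne_top (ENNReal.tsum_le_tsum fun n => ?_)
    simp_rw [edist_dist]
    rw [← ofReal_integral_eq_lintegral_ofReal (hint n) (ae_of_all _ fun _ => dist_nonneg)]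
    exact ENNReal.ofReal_le_ofReal (integral_dist_codingApprox_le h_contr hx h_inv hM n)
  filter_upwards [ae_lt_top (Measurable.tsum hmeas) hfin] with σ hσ
  exact cauchySeq_tendsto_of_complete
    (cauchySeq_of_edist_le_of_tsum_ne_top _ (fun n => le_rfl) hσ.ne)

theorem ae_mem_codingCore [ProperSpace K] {a : ℝ} (h_contr : 𝓜.IsContractive a) {x : V → K}
    (hx : ∀ v, x v ∈ 𝓜.vertexSet v) (h_inv : 𝓜.adjointOp μ = μ)
    (hM : ∀ j n (u : Fin n → E), M.real (window j n ⁻¹' {u}) = 𝓜.blockProb μ u)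
    (hMS : ∀ i, MeasurePreserving (shiftBy E i) M M) :
    ∀ᵐ σ ∂M, σ ∈ 𝓜.codingCore x := by
  have h1 : ∀ᵐ σ ∂M, σ ∈ 𝓜.codingDomain x := by
    filter_upwards [ae_mem_pathSpace hM, ae_exists_tendsto_codingApprox h_contr hx h_inv hM]
      with σ h2 h3 using ⟨h2, h3⟩
  have h2 : ∀ᵐ σ ∂M, ∀ j : ℤ, shiftBy E j σ ∈ 𝓜.codingDomain x :=
    ae_all_iff.2 fun j => (hMS j).quasiMeasurePreserving.ae h1
  filter_upwards [h2] with σ hσ using (𝓜.mem_codingCore_iff).2 hσ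

end MarkovMeasure

/-! ### The energy and the pressure -/

section Pointwise

variable {V E K : Type*} [Fintype E] [MeasurableSpace K] {𝓜 : MarkovSystem V E K}

/-- The logarithmic loss along the approximants of the coding map. -/
noncomputable def codingLossApprox (𝓜 : MarkovSystem V E K) (x : V → K) (n : ℕ) (σ : ℤ → E) : ℝ :=
  -Real.log (𝓜.p (σ 1) (𝓜.codingApprox x σ n))

theorem codingLossApprox_eq (x : V → K) (n : ℕ) (σ : ℤ → E) :
    𝓜.codingLossApprox x n σ =
      (fun v : Fin (n + 1 + 1) → E => -Real.log (𝓜.p (v (Fin.last _)) (𝓜.wordEnd x (Fin.init v))))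
        (window (-(n : ℤ)) (n + 1 + 1) σ) := by
  simp only [window_succ_eq_snoc (-(n : ℤ)) (n + 1) σ, Fin.snoc_last, Fin.init_snoc,
    codingLossApprox, codingApprox_eq_wordEnd]
  congr 3
  push_cast
  congr 1
  ring

theorem neg_log_p_nonneg (e : E) (y : K) : 0 ≤ -Real.log (𝓜.p e y) :=
  neg_nonneg.2 (Real.log_nonpos (𝓜.p_nonneg e y) (𝓜.p_le_one e y))

theorem measurable_codingLossApprox [MeasurableSpace E] [DiscreteMeasurableSpace E] (x : V → K) (n : ℕ) :
    Measurable (𝓜.codingLossApprox x n) := by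
  rw [funext (codingLossApprox_eq x n)]
  exact measurable_of_comp_finite (measurable_window _ _)
    fun v : Fin (n + 1 + 1) → E => -Real.log (𝓜.p (v (Fin.last _)) (𝓜.wordEnd x (Fin.init v)))

theorem abs_codingLossApprox_le {δ : ℝ} (hδ : 0 < δ)
    (h_pos : ∀ e, ∀ y ∈ 𝓜.vertexSet (𝓜.ini e), δ ≤ 𝓜.p e y) {x : V → K}
    (hx : ∀ v, x v ∈ 𝓜.vertexSet v) {σ : ℤ → E} (h : σ ∈ 𝓜.pathSpace) (n : ℕ) :
    |𝓜.codingLossApprox x n σ| ≤ -Real.log δ := by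
  rw [codingLossApprox, abs_of_nonneg (neg_log_p_nonneg _ _)]
  exact neg_le_neg (Real.log_le_log hδ (h_pos _ _ (𝓜.codingApprox_mem hx h n)))

end Pointwise

/-! ### Convergence of the loss and a modulus of continuity -/

section Limit

variable {V E K : Type*} [Fintype E] [MetricSpace K] [MeasurableSpace K]
  {𝓜 : MarkovSystem V E K}

/-- The logarithmic loss `-log p_{σ_1}(F(σ))`. -/
noncomputable def codingLoss (𝓜 : MarkovSystem V E K) (x : V → K) (σ : ℤ → E) : ℝ :=
  -Real.log (𝓜.p (σ 1) (𝓜.codingMap x σ))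

variable {δ : ℝ}

theorem tendsto_p_codingApprox (h_open : ∀ v, IsOpen (𝓜.vertexSet v))
    (h_unif : ∀ e, UniformContinuousOn (𝓜.p e) (𝓜.vertexSet (𝓜.ini e))) {x : V → K}
    (hx : ∀ v, x v ∈ 𝓜.vertexSet v) {σ : ℤ → E} (h : σ ∈ 𝓜.codingDomain x) :
    Tendsto (fun n => 𝓜.p (σ 1) (𝓜.codingApprox x σ n)) atTop
      (𝓝 (𝓜.p (σ 1) (𝓜.codingMap x σ))) :=
  ((h_unif _).continuousOn.continuousAt
    ((h_open _).mem_nhds (𝓜.codingMap_mem h_open hx h))).tendsto.comp (𝓜.tendsto_codingMap h)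

theorem tendsto_codingLossApprox (hδ : 0 < δ)
    (h_pos : ∀ e, ∀ y ∈ 𝓜.vertexSet (𝓜.ini e), δ ≤ 𝓜.p e y)
    (h_open : ∀ v, IsOpen (𝓜.vertexSet v))
    (h_unif : ∀ e, UniformContinuousOn (𝓜.p e) (𝓜.vertexSet (𝓜.ini e))) {x : V → K}
    (hx : ∀ v, x v ∈ 𝓜.vertexSet v) {σ : ℤ → E} (h : σ ∈ 𝓜.codingDomain x) :
    Tendsto (fun n => 𝓜.codingLossApprox x n σ) atTop (𝓝 (𝓜.codingLoss x σ)) :=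
  ((tendsto_p_codingApprox h_open h_unif hx h).log
    (hδ.trans_le (h_pos _ _ (𝓜.codingMap_mem h_open hx h))).ne').neg

theorem toENNReal_neg_energy (hδ : 0 < δ)
    (h_pos : ∀ e, ∀ y ∈ 𝓜.vertexSet (𝓜.ini e), δ ≤ 𝓜.p e y)
    (h_open : ∀ v, IsOpen (𝓜.vertexSet v)) {x : V → K}
    (hx : ∀ v, x v ∈ 𝓜.vertexSet v) {σ : ℤ → E} (hσ : σ ∈ 𝓜.codingCore x) :
    (-(𝓜.energy x σ)).toENNReal = ENNReal.ofReal (𝓜.codingLoss x σ) := by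
  have hp : 0 < 𝓜.p (σ 1) (𝓜.codingMap x σ) :=
    hδ.trans_le (h_pos _ _ (𝓜.codingMap_mem h_open hx (𝓜.codingCore_subset_codingDomain hσ)))
  rw [energy, if_pos hσ, ENNReal.log_ofReal_of_pos hp, ← EReal.coe_neg,
    EReal.toENNReal_of_ne_top (EReal.coe_ne_top _), EReal.toReal_coe]
  rfl

/-- A modulus of continuity for `log p_e`. -/
theorem exists_neg_log_p_le {δ : ℝ} (hδ : 0 < δ)
    (h_pos : ∀ e, ∀ y ∈ 𝓜.vertexSet (𝓜.ini e), δ ≤ 𝓜.p e y)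
    (h_unif : ∀ e, UniformContinuousOn (𝓜.p e) (𝓜.vertexSet (𝓜.ini e))) {ε : ℝ} (hε : 0 < ε) :
    ∃ C, 0 ≤ C ∧ ∀ e, ∀ y ∈ 𝓜.vertexSet (𝓜.ini e), ∀ z ∈ 𝓜.vertexSet (𝓜.ini e),
      -Real.log (𝓜.p e z) ≤ -Real.log (𝓜.p e y) + (ε + C * dist y z) := by
  have key : ∀ e, ∃ C, 0 ≤ C ∧ ∀ y ∈ 𝓜.vertexSet (𝓜.ini e), ∀ z ∈ 𝓜.vertexSet (𝓜.ini e),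
      -Real.log (𝓜.p e z) ≤ -Real.log (𝓜.p e y) + (ε + C * dist y z) := by
    intro e
    obtain ⟨η, hη, hu⟩ := Metric.uniformContinuousOn_iff.1 (h_unif e) (ε * δ) (by positivity)
    -- For points closer than η, uniform continuity gives p_e(y) - p_e(z) < εδ ≤ ε p_e(z). For the
    -- others, C · dist · δ ≥ 1 already dominates p_e(y).
    refine ⟨1 / (δ * η), by positivity, fun y hy z hz => ?_⟩
    have hpy : 0 < 𝓜.p e y := hδ.trans_le (h_pos e y hy)
    have hpz : 0 < 𝓜.p e z := hδ.trans_le (h_pos e z hz)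
    have h1 := Real.log_le_sub_one_of_pos (div_pos hpy hpz)
    rw [Real.log_div hpy.ne' hpz.ne'] at h1
    have h2 : 𝓜.p e y / 𝓜.p e z - 1 ≤ ε + 1 / (δ * η) * dist y z := by
      rw [div_sub_one hpz.ne', div_le_iff₀ hpz]
      have h4 := h_pos e z hz
      have h5 : 0 ≤ 1 / (δ * η) * dist y z := by positivity
      rcases lt_or_ge (dist y z) η with h3 | h3
      · have := hu y hy z hz h3
        rw [Real.dist_eq] at this
        have := (le_abs_self _).trans this.le
        nlinarith
      · have h6 : 1 ≤ 1 / (δ * η) * dist y z * δ := by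
          rw [show 1 / (δ * η) * dist y z * δ = dist y z / η by field_simp]
          rwa [le_div_iff₀ hη, one_mul]
        have := 𝓜.p_le_one e y
        nlinarith
    linarith
  choose C hC0 hC using key
  refine ⟨∑ e, C e, Finset.sum_nonneg fun e _ => hC0 e, fun e y hy z hz =>
    (hC e y hy z hz).trans ?_⟩
  have : C e ≤ ∑ e, C e := Finset.single_le_sum (fun e _ => hC0 e) (Finset.mem_univ e)
  gcongr

end Limit

/-! ### Integrals of the energy -/

section Energy

variable {V E K : Type*} [Fintype E] [MeasurableSpace E] [DiscreteMeasurableSpace E]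
  [MetricSpace K] [MeasurableSpace K] {𝓜 : MarkovSystem V E K}

/-- Off Y the loss is infinite, so a complement of positive measure makes the integral -∞.
Measurability of Y allows its complement to be used as a lower bound. -/
theorem ae_mem_codingCore_of_energyIntegral_ne_bot {ν : Measure (ℤ → E)} [ProperSpace K] [BorelSpace K] {x : V → K}
    (h : energyIntegral ν (𝓜.energy x) ≠ ⊥) : ∀ᵐ σ ∂ν, σ ∈ 𝓜.codingCore x := by
  by_contra hne
  rw [ae_iff] at hne
  refine h ?_
  have h1 : ∫⁻ σ, (-(𝓜.energy x σ)).toENNReal ∂ν = ⊤ := by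
    refine top_unique ?_
    calc (⊤ : ENNReal) = ∫⁻ σ, (𝓜.codingCore x)ᶜ.indicator (fun _ => ⊤) σ ∂ν := by
          rw [lintegral_indicator_const (measurableSet_codingCore x).compl]
          exact (ENNReal.top_mul hne).symm
      _ ≤ _ := by
          refine lintegral_mono fun σ => ?_
          by_cases hσ : σ ∈ 𝓜.codingCore x
          · rw [indicator_of_notMem (by simpa using hσ)]
            exact zero_le
          · simp [energy, hσ]
  rw [energyIntegral, h1]
  simp

variable {δ : ℝ} {ν : Measure (ℤ → E)} [IsProbabilityMeasure ν]

/-- Along a path every approximant lies where p_{σ_1} ≥ δ, so the constant -log δ dominates. -/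
theorem tendsto_integral_codingLossApprox (hδ : 0 < δ)
    (h_pos : ∀ e, ∀ y ∈ 𝓜.vertexSet (𝓜.ini e), δ ≤ 𝓜.p e y)
    (h_open : ∀ v, IsOpen (𝓜.vertexSet v))
    (h_unif : ∀ e, UniformContinuousOn (𝓜.p e) (𝓜.vertexSet (𝓜.ini e))) {x : V → K}
    (hx : ∀ v, x v ∈ 𝓜.vertexSet v) (hν : ∀ᵐ σ ∂ν, σ ∈ 𝓜.codingCore x) :
    Tendsto (fun n => ∫ σ, 𝓜.codingLossApprox x n σ ∂ν) atTop
      (𝓝 (∫ σ, 𝓜.codingLoss x σ ∂ν)) := by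
  refine tendsto_integral_of_dominated_convergence (fun _ => -Real.log δ)
    (fun n => (measurable_codingLossApprox x n).aestronglyMeasurable) (integrable_const _)
    (fun n => ?_) ?_
  · filter_upwards [hν] with σ hσ
    exact abs_codingLossApprox_le hδ h_pos hx (𝓜.codingCore_subset_codingDomain hσ).1 n
  · filter_upwards [hν] with σ hσ
    exact tendsto_codingLossApprox hδ h_pos h_open h_unif hx (𝓜.codingCore_subset_codingDomain hσ)

theorem integrable_codingLoss (hδ : 0 < δ)
    (h_pos : ∀ e, ∀ y ∈ 𝓜.vertexSet (𝓜.ini e), δ ≤ 𝓜.p e y)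
    (h_open : ∀ v, IsOpen (𝓜.vertexSet v))
    (h_unif : ∀ e, UniformContinuousOn (𝓜.p e) (𝓜.vertexSet (𝓜.ini e))) {x : V → K}
    (hx : ∀ v, x v ∈ 𝓜.vertexSet v) (hν : ∀ᵐ σ ∂ν, σ ∈ 𝓜.codingCore x) :
    Integrable (𝓜.codingLoss x) ν := by
  have hm : AEMeasurable (𝓜.codingLoss x) ν :=
    aemeasurable_of_tendsto_metrizable_ae atTop
      (fun n => (measurable_codingLossApprox x n).aemeasurable) (by
        filter_upwards [hν] with σ hσ
        exact tendsto_codingLossApprox hδ h_pos h_open h_unif hx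
          (𝓜.codingCore_subset_codingDomain hσ))
  refine Integrable.of_bound hm.aestronglyMeasurable (-Real.log δ) ?_
  filter_upwards [hν] with σ hσ
  rw [codingLoss, Real.norm_eq_abs, abs_of_nonneg (neg_log_p_nonneg _ _)]
  exact neg_le_neg (Real.log_le_log hδ
    (h_pos _ _ (𝓜.codingMap_mem h_open hx (𝓜.codingCore_subset_codingDomain hσ))))

theorem energyIntegral_energy (hδ : 0 < δ)
    (h_pos : ∀ e, ∀ y ∈ 𝓜.vertexSet (𝓜.ini e), δ ≤ 𝓜.p e y)
    (h_open : ∀ v, IsOpen (𝓜.vertexSet v))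
    (h_unif : ∀ e, UniformContinuousOn (𝓜.p e) (𝓜.vertexSet (𝓜.ini e))) {x : V → K}
    (hx : ∀ v, x v ∈ 𝓜.vertexSet v) (hν : ∀ᵐ σ ∂ν, σ ∈ 𝓜.codingCore x) :
    energyIntegral ν (𝓜.energy x) = ((-∫ σ, 𝓜.codingLoss x σ ∂ν : ℝ) : EReal) := by
  have h1 : ∫⁻ σ, (-(𝓜.energy x σ)).toENNReal ∂ν =
      ENNReal.ofReal (∫ σ, 𝓜.codingLoss x σ ∂ν) := by
    rw [ofReal_integral_eq_lintegral_ofReal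
      (integrable_codingLoss hδ h_pos h_open h_unif hx hν)
      (ae_of_all _ fun σ => neg_log_p_nonneg _ _)]
    refine lintegral_congr_ae ?_
    filter_upwards [hν] with σ hσ using toENNReal_neg_energy hδ h_pos h_open hx hσ
  rw [energyIntegral, h1, EReal.coe_ennreal_ofReal, max_eq_left, EReal.coe_neg]
  exact integral_nonneg fun σ => neg_log_p_nonneg _ _

end Energy

/-! ### Non-negativity of the pressure -/

section Pressure

variable {V E K : Type*} [Fintype V] [Fintype E] [MeasurableSpace E] [DiscreteMeasurableSpace E]
  [MetricSpace K] [MeasurableSpace K] [BorelSpace K] {𝓜 : MarkovSystem V E K}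

variable {μ : Measure K} [IsProbabilityMeasure μ] {M : Measure (ℤ → E)} [IsProbabilityMeasure M]
  {δ a : ℝ}

/-- Under M the next edge is drawn at the true end point of a word, while the loss is evaluated at
the end point started from the reference point. The modulus of continuity exchanges the two at cost
ε + C · dist, the expected distance is at most a^(n+1) times the initial one, and stationarity turns
the entropy at the end point into its μ-mean. -/
theorem integral_codingLossApprox_le (h_contr : 𝓜.IsContractive a)
    {x : V → K} (hx : ∀ v, x v ∈ 𝓜.vertexSet v) (h_inv : 𝓜.adjointOp μ = μ)
    (hM : ∀ j n (u : Fin n → E), M.real (window j n ⁻¹' {u}) = 𝓜.blockProb μ u) {ε C : ℝ}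
    (hC0 : 0 ≤ C)
    (hC : ∀ e, ∀ y ∈ 𝓜.vertexSet (𝓜.ini e), ∀ z ∈ 𝓜.vertexSet (𝓜.ini e),
      -Real.log (𝓜.p e z) ≤ -Real.log (𝓜.p e y) + (ε + C * dist y z)) (n : ℕ) :
    ∫ σ, 𝓜.codingLossApprox x n σ ∂M ≤
      (∫ y, 𝓜.stepEntropy y ∂μ) + ε + C * a ^ (n + 1) * ∫ y, 𝓜.cellDist x y ∂μ := by
  have hi1 : Integrable (fun y => ∑ u : Fin (n + 1) → E,
      𝓜.wordProb u y * 𝓜.stepEntropy (𝓜.wordMap u y)) μ := by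
    refine integrable_finsetSum _ fun u _ => ?_
    refine (integrable_of_abs_le (μ := μ) (𝓜.measurable_stepEntropy.comp (𝓜.measurable_wordMap u))
      fun y => 𝓜.abs_stepEntropy_le _).bdd_mul (c := 1)
      (𝓜.measurable_wordProb u).aestronglyMeasurable (ae_of_all _ fun y => abs_wordProb_le u y)
  have hi2 : Integrable (fun y => C * a ^ (n + 1) * 𝓜.cellDist x y) μ :=
    (integrable_cellDist h_contr hx h_inv).const_mul _
  rw [← integral_sum_wordProb h_inv (n + 1) 𝓜.measurable_stepEntropy 𝓜.abs_stepEntropy_le,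
    ← integral_const_mul]
  have hε : ε = ∫ _, ε ∂μ := by simp
  rw [hε, ← integral_add hi1 (integrable_const ε)]
  have hi3 : Integrable (fun y => (∑ u : Fin (n + 1) → E,
      𝓜.wordProb u y * 𝓜.stepEntropy (𝓜.wordMap u y)) + ε) μ := hi1.add (integrable_const ε)
  rw [← integral_add hi3 hi2]
  simp_rw [codingLossApprox_eq]
  rw [integral_window hM (-(n : ℤ)) (n := n + 1 + 1)
    fun v => -Real.log (𝓜.p (v (Fin.last _)) (𝓜.wordEnd x (Fin.init v)))]
  refine integral_mono (integrable_finsetSum _ fun u _ => (integrable_wordProb u).mul_const _)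
    (hi3.add hi2) fun y => ?_
  simp only
  obtain ⟨v, hv⟩ := 𝓜.exists_mem_vertexSet y
  rw [sum_word_succ_snoc]
  simp only [wordProb_snoc, Fin.snoc_last, Fin.init_snoc]
  calc _ ≤ ∑ u : Fin (n + 1) → E, (𝓜.wordProb u y * 𝓜.stepEntropy (𝓜.wordMap u y) +
        𝓜.wordProb u y * ε + C * (𝓜.wordProb u y * dist (𝓜.wordMap u y) (𝓜.wordEnd x u))) := by
        refine Finset.sum_le_sum fun u _ => ?_
        by_cases hu : 𝓜.wordProb u y = 0
        · simp [hu]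
        have hsame : 𝓜.SameCell (𝓜.wordMap u y) (𝓜.wordEnd x u) := by
          rw [wordEnd, ini_of_wordProb_ne_zero hu hv]
          exact SameCell.word 𝓜 ⟨v, hv, hx v⟩ hu
        simp_rw [mul_assoc]
        rw [← Finset.mul_sum, mul_left_comm C, ← mul_add, ← mul_add]
        refine mul_le_mul_of_nonneg_left ?_ (𝓜.wordProb_nonneg u y)
        -- Edges of probability zero contribute nothing; for the others both end points lie in the
        -- initial cell of e, where `hC` applies.
        calc _ ≤ ∑ e, (Real.negMulLog (𝓜.p e (𝓜.wordMap u y)) + 𝓜.p e (𝓜.wordMap u y) *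
              (ε + C * dist (𝓜.wordMap u y) (𝓜.wordEnd x u))) := by
              refine Finset.sum_le_sum fun e _ => ?_
              by_cases he : 𝓜.p e (𝓜.wordMap u y) = 0
              · simp [he]
              have h1 := 𝓜.mem_of_p_ne_zero he
              obtain ⟨v', h2, h3⟩ := hsame
              obtain rfl := 𝓜.eq_of_mem_vertexSet h2 h1
              rw [Real.negMulLog, neg_mul, ← mul_neg, ← mul_add]
              exact mul_le_mul_of_nonneg_left (hC e _ h2 _ h3) (𝓜.p_nonneg _ _)
          _ = _ := by
              rw [Finset.sum_add_distrib, ← Finset.sum_mul, 𝓜.p_sum, one_mul, stepEntropy]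
              ring
    _ = (∑ u : Fin (n + 1) → E, 𝓜.wordProb u y * 𝓜.stepEntropy (𝓜.wordMap u y)) + ε +
        C * ∑ u : Fin (n + 1) → E,
          𝓜.wordProb u y * dist (𝓜.wordMap u y) (𝓜.wordEnd x u) := by
        rw [Finset.sum_add_distrib, Finset.sum_add_distrib, ← Finset.sum_mul, 𝓜.sum_wordProb,
          one_mul, ← Finset.mul_sum]
    _ ≤ _ := by
        rw [mul_assoc]
        exact add_le_add le_rfl
          (mul_le_mul_of_nonneg_left (sum_wordProb_dist_wordEnd_le h_contr hx n y) hC0)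

theorem integral_codingLoss_le (h_contr : 𝓜.IsContractive a) (hδ : 0 < δ)
    (h_pos : ∀ e, ∀ y ∈ 𝓜.vertexSet (𝓜.ini e), δ ≤ 𝓜.p e y)
    (h_open : ∀ v, IsOpen (𝓜.vertexSet v))
    (h_unif : ∀ e, UniformContinuousOn (𝓜.p e) (𝓜.vertexSet (𝓜.ini e)))
    {x : V → K} (hx : ∀ v, x v ∈ 𝓜.vertexSet v) (h_inv : 𝓜.adjointOp μ = μ)
    (hM : ∀ j n (u : Fin n → E), M.real (window j n ⁻¹' {u}) = 𝓜.blockProb μ u)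
    (hcore : ∀ᵐ σ ∂M, σ ∈ 𝓜.codingCore x) :
    ∫ σ, 𝓜.codingLoss x σ ∂M ≤ ∫ y, 𝓜.stepEntropy y ∂μ := by
  refine le_of_forall_pos_le_add fun ε hε => ?_
  obtain ⟨C, hC0, hC⟩ := exists_neg_log_p_le hδ h_pos h_unif hε
  have h1 : Tendsto (fun n : ℕ => (∫ y, 𝓜.stepEntropy y ∂μ) + ε +
      C * a ^ (n + 1) * ∫ y, 𝓜.cellDist x y ∂μ) atTop
      (𝓝 ((∫ y, 𝓜.stepEntropy y ∂μ) + ε + C * 0 * ∫ y, 𝓜.cellDist x y ∂μ)) :=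
    ((((tendsto_add_atTop_iff_nat 1).2 (tendsto_pow_atTop_nhds_zero_of_lt_one h_contr.1.le
      h_contr.2.1)).const_mul C).mul_const _).const_add _
  rw [mul_zero, zero_mul, add_zero] at h1
  exact le_of_tendsto_of_tendsto' (tendsto_integral_codingLossApprox hδ h_pos h_open h_unif hx hcore)
    h1 fun n => integral_codingLossApprox_le h_contr hx h_inv hM hC0 hC n

theorem integral_stepEntropy_le_ksEntropy {V E K : Type*} [Fintype E] [MeasurableSpace E]
    [DiscreteMeasurableSpace E] [MeasurableSpace K] {𝓜 : MarkovSystem V E K} {μ : Measure K}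
    [IsProbabilityMeasure μ] {M : Measure (ℤ → E)} [IsProbabilityMeasure M]
    (h_inv : 𝓜.adjointOp μ = μ)
    (hM : ∀ j n (u : Fin n → E), M.real (window j n ⁻¹' {u}) = 𝓜.blockProb μ u) :
    ((∫ y, 𝓜.stepEntropy y ∂μ : ℝ) : EReal) ≤ ksEntropy (codeShift E) M := by
  set φ := Fintype.equivFin E with hφ
  have hξ : Measurable fun σ : ℤ → E => φ (σ 0) :=
    (measurable_of_finite φ).comp (measurable_pi_apply (0 : ℤ))
  -- A lower bound needs one partition only, the one by the letter at 0, whose itineraries are the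
  -- blocks of M.
  refine le_trans ?_ (le_iSup_of_le (Fintype.card E) (le_iSup_of_le (fun σ : ℤ → E => φ (σ 0))
    (le_iSup_of_le hξ le_rfl)))
  refine le_limsup_of_frequently_le (Eventually.frequently ?_) (by isBoundedDefault)
  filter_upwards [eventually_gt_atTop 0] with n hn
  rw [EReal.coe_le_coe_iff, le_div_iff₀ (by exact_mod_cast hn), mul_comm]
  refine (𝓜.le_sum_negMulLog_blockProb h_inv n).trans (le_of_eq ?_)
  rw [partitionEntropy, ← (Equiv.arrowCongr (Equiv.refl (Fin n)) φ).sum_comp]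
  refine Finset.sum_congr rfl fun u _ => ?_
  rw [← hM 0 n u]
  congr 2
  ext σ
  simp only [mem_preimage, mem_singleton_iff, funext_iff, itinerary, codeShift_iterate, window,
    Equiv.arrowCongr_apply, Equiv.coe_refl, Equiv.refl_symm, Function.comp_apply, id_eq,
    φ.apply_eq_iff_eq]

/-- The pressure of the energy is non-negative, as witnessed by the generalized Markov measure. -/
theorem pressure_energy_nonneg [ProperSpace K] (h_contr : 𝓜.IsContractive a) (hδ : 0 < δ)
    (h_pos : ∀ e, ∀ y ∈ 𝓜.vertexSet (𝓜.ini e), δ ≤ 𝓜.p e y)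
    (h_open : ∀ v, IsOpen (𝓜.vertexSet v))
    (h_unif : ∀ e, UniformContinuousOn (𝓜.p e) (𝓜.vertexSet (𝓜.ini e)))
    {x : V → K} (hx : ∀ v, x v ∈ 𝓜.vertexSet v) (h_inv : 𝓜.adjointOp μ = μ) :
    0 ≤ pressure (codeShift E) (𝓜.energy x) := by
  obtain ⟨M, hMp, hMS, hM⟩ := 𝓜.exists_markovMeasure h_inv
  have hcore := ae_mem_codingCore h_contr hx h_inv hM hMS
  refine le_trans ?_ (le_iSup₂_of_le M ⟨hMp, hMS 1⟩ le_rfl)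
  rw [energyIntegral_energy hδ h_pos h_open h_unif hx hcore]
  -- Entropy is at least, and loss at most, the mean step entropy, so that quantity cancels.
  refine le_trans ?_ (add_le_add (integral_stepEntropy_le_ksEntropy h_inv hM) le_rfl)
  rw [← EReal.coe_add, ← EReal.coe_zero, EReal.coe_le_coe_iff]
  have := integral_codingLoss_le h_contr hδ h_pos h_open h_unif hx h_inv hM hcore
  linarith

end Pressure

/-! ### Equilibrium states -/

section Tilt

variable {V E K : Type*} [Fintype E] [MeasurableSpace K] (𝓜 : MarkovSystem V E K)

/-- The increment of `f` along the edge `e`, centred by its conditional mean. -/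
noncomputable def increment (f : K → ℝ) (e : E) (y : K) : ℝ := f (𝓜.w e y) - 𝓜.markovOp f y

theorem sum_p_mul_increment (f : K → ℝ) (y : K) : ∑ e, 𝓜.p e y * 𝓜.increment f e y = 0 := by
  simp only [increment, mul_sub, Finset.sum_sub_distrib, ← Finset.sum_mul, 𝓜.p_sum, one_mul]
  exact sub_self _

theorem abs_increment_le {f : K → ℝ} {C : ℝ} (hC : ∀ y, |f y| ≤ C) (e : E) (y : K) :
    |𝓜.increment f e y| ≤ 2 * C := by
  refine (abs_sub _ _).trans ?_
  linarith [hC (𝓜.w e y), 𝓜.abs_markovOp_le hC y]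

theorem half_le_one_add_mul_increment {f : K → ℝ} {C : ℝ} (hC : ∀ y, |f y| ≤ C) {t : ℝ}
    (ht : |t| * (2 * C) ≤ 1 / 2) (e : E) (y : K) :
    1 / 2 ≤ 1 + t * 𝓜.increment f e y ∧ 1 + t * 𝓜.increment f e y ≤ 3 / 2 := by
  have h1 : |t * 𝓜.increment f e y| ≤ 1 / 2 := by
    rw [abs_mul]
    exact (mul_le_mul_of_nonneg_left (𝓜.abs_increment_le hC e y) (abs_nonneg t)).trans ht
  rw [abs_le] at h1
  constructor <;> linarith [h1.1, h1.2]

/-- The transition probabilities reweighted in favour of the increments of `f`. -/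
noncomputable def tilt (f : K → ℝ) (t : ℝ) (e : E) (y : K) : ℝ :=
  𝓜.p e y * (1 + t * 𝓜.increment f e y)

theorem sum_tilt (f : K → ℝ) (t : ℝ) (y : K) : ∑ e, 𝓜.tilt f t e y = 1 := by
  have h : ∀ e, 𝓜.tilt f t e y = 𝓜.p e y + t * (𝓜.p e y * 𝓜.increment f e y) := fun e => by
    rw [tilt]; ring
  simp_rw [h]
  rw [Finset.sum_add_distrib, ← Finset.mul_sum, 𝓜.sum_p_mul_increment, 𝓜.p_sum, mul_zero, add_zero]

theorem abs_log_le_one {s : ℝ} (h1 : 1 / 2 ≤ s) (h2 : s ≤ 3 / 2) : |Real.log s| ≤ 1 := by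
  have hs : 0 < s := by linarith
  have h3 := Real.log_le_sub_one_of_pos hs
  have h4 := Real.log_le_sub_one_of_pos (inv_pos.2 hs)
  rw [Real.log_inv] at h4
  have h5 : s⁻¹ ≤ 2 := by
    rw [inv_le_comm₀ hs two_pos]; linarith
  rw [abs_le]
  constructor <;> linarith

/-- The quadratic lower bound that lets the first-order term in t dominate for small t. -/
theorem sub_le_log_one_add {s : ℝ} (hs : -(1 / 2) ≤ s) : s - 2 * s ^ 2 ≤ Real.log (1 + s) := by
  have h0 : 0 < 1 + s := by linarith
  refine le_trans ?_ (Real.one_sub_inv_le_log_of_pos h0)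
  rw [← sub_nonneg, show 1 - (1 + s)⁻¹ - (s - 2 * s ^ 2) = s ^ 2 * (1 + 2 * s) / (1 + s) by
    field_simp; ring]
  exact div_nonneg (mul_nonneg (sq_nonneg s) (by linarith)) h0.le

theorem measurable_increment_codingApprox [MeasurableSpace E] [DiscreteMeasurableSpace E]
    (f : K → ℝ) (x : V → K) (n : ℕ) :
    Measurable fun σ : ℤ → E => 𝓜.increment f (σ 1) (𝓜.codingApprox x σ n) := by
  simp_rw [codingApprox_eq_wordEnd]
  exact measurable_of_comp_finite
    ((measurable_window (-(n : ℤ)) (n + 1)).prodMk (measurable_pi_apply (1 : ℤ)))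
    fun v : (Fin (n + 1) → E) × E => 𝓜.increment f v.2 (𝓜.wordEnd x v.1)

end Tilt

theorem tendsto_increment_codingApprox {V E K : Type*} [Fintype E]
    [MetricSpace K] [MeasurableSpace K] {𝓜 : MarkovSystem V E K} {x : V → K} {f : K → ℝ} {a δ : ℝ} (h_contr : 𝓜.IsContractive a) (hδ : 0 < δ)
    (h_pos : ∀ e, ∀ y ∈ 𝓜.vertexSet (𝓜.ini e), δ ≤ 𝓜.p e y)
    (h_open : ∀ v, IsOpen (𝓜.vertexSet v))
    (h_unif : ∀ e, UniformContinuousOn (𝓜.p e) (𝓜.vertexSet (𝓜.ini e)))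
    (hx : ∀ v, x v ∈ 𝓜.vertexSet v) (hf : Continuous f) {σ : ℤ → E}
    (hσ : σ ∈ 𝓜.codingDomain x) :
    Tendsto (fun n => 𝓜.increment f (σ 1) (𝓜.codingApprox x σ n)) atTop
      (𝓝 (𝓜.increment f (σ 1) (𝓜.codingMap x σ))) := by
  have h1 : ContinuousAt (𝓜.increment f (σ 1)) (𝓜.codingMap x σ) :=
    (hf.continuousAt.comp ((continuousOn_w h_contr hδ h_pos (σ 1)).continuousAt
      ((h_open _).mem_nhds (𝓜.codingMap_mem h_open hx hσ)))).sub
      (continuous_markovOp h_contr hδ h_pos h_open h_unif hf).continuousAt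
  exact h1.tendsto.comp (𝓜.tendsto_codingMap hσ)

theorem aemeasurable_codingMap {V E K : Type*} [Fintype E] [MeasurableSpace E]
    [DiscreteMeasurableSpace E] [MetricSpace K] [MeasurableSpace K] [BorelSpace K]
    {𝓜 : MarkovSystem V E K} {Λ : Measure (ℤ → E)} {x : V → K}
    (hΛ : ∀ᵐ σ ∂Λ, σ ∈ 𝓜.codingCore x) :
    AEMeasurable (𝓜.codingMap x) Λ :=
  aemeasurable_of_tendsto_metrizable_ae atTop
    (fun n => (𝓜.measurable_codingApprox x n).aemeasurable) (by
      filter_upwards [hΛ] with σ hσ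
      exact 𝓜.tendsto_codingMap (𝓜.codingCore_subset_codingDomain hσ))

/-! ### First variation at a measure of non-negative free energy -/

section Equilibrium

variable {V E K : Type*} [Fintype E] [MeasurableSpace E] [DiscreteMeasurableSpace E]
  [MetricSpace K] [MeasurableSpace K] {𝓜 : MarkovSystem V E K} {Λ : Measure (ℤ → E)}
  [IsProbabilityMeasure Λ] {x : V → K} {f : K → ℝ} {C : ℝ}

/-- The tilted probabilities at the n-th approximant depend on σ_{-n}, …, σ_0 only, so they are an
admissible predictor for each n. F itself depends on the whole past, so it is reached by dominated
convergence. -/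
theorem ksEntropy_le_integral_tilt {a δ : ℝ} (h_contr : 𝓜.IsContractive a) (hδ : 0 < δ)
    (h_pos : ∀ e, ∀ y ∈ 𝓜.vertexSet (𝓜.ini e), δ ≤ 𝓜.p e y)
    (h_open : ∀ v, IsOpen (𝓜.vertexSet v))
    (h_unif : ∀ e, UniformContinuousOn (𝓜.p e) (𝓜.vertexSet (𝓜.ini e)))
    (hx : ∀ v, x v ∈ 𝓜.vertexSet v) (hS : MeasurePreserving (codeShift E) Λ Λ)
    (hΛ : ∀ᵐ σ ∂Λ, σ ∈ 𝓜.codingCore x) (hf : Continuous f) (hC : ∀ y, |f y| ≤ C) {t : ℝ}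
    (ht : |t| * (2 * C) ≤ 1 / 2) :
    ksEntropy (codeShift E) Λ ≤ (((∫ σ, 𝓜.codingLoss x σ ∂Λ) -
      ∫ σ, Real.log (1 + t * 𝓜.increment f (σ 1) (𝓜.codingMap x σ)) ∂Λ : ℝ) : EReal) := by
  have hb := 𝓜.half_le_one_add_mul_increment hC ht
  have hlog : ∀ e y, |Real.log (1 + t * 𝓜.increment f e y)| ≤ 1 := fun e y =>
    abs_log_le_one (hb e y).1 (hb e y).2
  have hm : ∀ n, Measurable fun σ : ℤ → E =>
      Real.log (1 + t * 𝓜.increment f (σ 1) (𝓜.codingApprox x σ n)) := fun n =>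
    Real.measurable_log.comp (((𝓜.measurable_increment_codingApprox f x n).const_mul t).const_add 1)
  have hlim1 := tendsto_integral_codingLossApprox hδ h_pos h_open h_unif hx hΛ
  have hlim2 : Tendsto (fun n => ∫ σ, Real.log
      (1 + t * 𝓜.increment f (σ 1) (𝓜.codingApprox x σ n)) ∂Λ) atTop
      (𝓝 (∫ σ, Real.log (1 + t * 𝓜.increment f (σ 1) (𝓜.codingMap x σ)) ∂Λ)) := by
    refine tendsto_integral_of_dominated_convergence (fun _ => 1)
      (fun n => (hm n).aestronglyMeasurable) (integrable_const _)
      (fun n => ae_of_all _ fun σ => hlog _ _) ?_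
    filter_upwards [hΛ] with σ hσ
    refine ((((tendsto_increment_codingApprox h_contr hδ h_pos h_open h_unif hx hf
      (𝓜.codingCore_subset_codingDomain hσ)).const_mul t).const_add 1).log ?_)
    have := (hb (σ 1) (𝓜.codingMap x σ)).1
    linarith
  have hlim := (continuous_coe_real_ereal.tendsto _).comp (hlim1.sub hlim2)
  refine ge_of_tendsto' hlim fun n => ?_
  have hpn : ∀ᵐ σ ∂Λ, 0 < 𝓜.p (σ 1) (𝓜.codingApprox x σ n) := by
    filter_upwards [hΛ] with σ hσ
    exact hδ.trans_le (h_pos _ _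
      (𝓜.codingApprox_mem hx (𝓜.codingCore_subset_codingDomain hσ).1 n))
  refine (ksEntropy_codeShift_le ⟨inferInstance, hS⟩
    (fun σ e => 𝓜.tilt f t e (𝓜.codingApprox x σ n)) n ?_ ?_ ?_ ?_).trans (le_of_eq ?_)
  · intro σ τ h
    simp only [codingApprox_eq_wordEnd, h]
  · intro σ e
    exact mul_nonneg (𝓜.p_nonneg _ _) (by linarith [(hb e (𝓜.codingApprox x σ n)).1])
  · intro σ
    exact (𝓜.sum_tilt f t _).le
  · filter_upwards [hpn] with σ hσ
    exact mul_pos hσ (by linarith [(hb (σ 1) (𝓜.codingApprox x σ n)).1])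
  · simp only [Function.comp_apply]
    congr 1
    rw [← integral_sub]
    · refine integral_congr_ae ?_
      filter_upwards [hpn] with σ hσ
      rw [tilt, Real.log_mul hσ.ne' (by linarith [(hb (σ 1) (𝓜.codingApprox x σ n)).1]),
        codingLossApprox]
      ring
    · rw [funext (codingLossApprox_eq x n)]
      exact integrable_comp_finite (measurable_window _ _)
        fun v : Fin (n + 1 + 1) → E => -Real.log (𝓜.p (v (Fin.last _)) (𝓜.wordEnd x (Fin.init v)))
    · exact Integrable.of_bound (hm n).aestronglyMeasurable 1 (ae_of_all _ fun σ => hlog _ _)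

/-- The increments of a bounded continuous function have mean zero if the free energy is
non-negative. -/
theorem integral_increment_eq_zero {a δ : ℝ} (h_contr : 𝓜.IsContractive a) (hδ : 0 < δ)
    (h_pos : ∀ e, ∀ y ∈ 𝓜.vertexSet (𝓜.ini e), δ ≤ 𝓜.p e y)
    (h_open : ∀ v, IsOpen (𝓜.vertexSet v))
    (h_unif : ∀ e, UniformContinuousOn (𝓜.p e) (𝓜.vertexSet (𝓜.ini e)))
    (hx : ∀ v, x v ∈ 𝓜.vertexSet v) (hS : MeasurePreserving (codeShift E) Λ Λ)
    (hΛ : ∀ᵐ σ ∂Λ, σ ∈ 𝓜.codingCore x)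
    (hfree : 0 ≤ ksEntropy (codeShift E) Λ + energyIntegral Λ (𝓜.energy x))
    (hf : Continuous f) (hC0 : 0 < C) (hC : ∀ y, |f y| ≤ C) :
    ∫ σ, 𝓜.increment f (σ 1) (𝓜.codingMap x σ) ∂Λ = 0 := by
  set θ : (ℤ → E) → ℝ := fun σ => 𝓜.increment f (σ 1) (𝓜.codingMap x σ) with hθ
  have hθb : ∀ σ, |θ σ| ≤ 2 * C := fun σ => 𝓜.abs_increment_le hC _ _
  have hθm : AEMeasurable θ Λ :=
    aemeasurable_of_tendsto_metrizable_ae atTop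
      (fun n => (𝓜.measurable_increment_codingApprox f x n).aemeasurable) (by
        filter_upwards [hΛ] with σ hσ
        exact tendsto_increment_codingApprox h_contr hδ h_pos h_open h_unif hx hf
          (𝓜.codingCore_subset_codingDomain hσ))
  have hθi : Integrable θ Λ :=
    Integrable.of_bound hθm.aestronglyMeasurable (2 * C) (ae_of_all _ hθb)
  set T : ℝ := ∫ σ, θ σ ∂Λ with hT
  have hTb : |T| ≤ 2 * C := by
    have h := norm_integral_le_of_norm_le_const (μ := Λ) (f := θ) (ae_of_all _ hθb)
    simpa using h
  -- The maximiser of t T - 8 C² t², the lower bound for ∫ log(1 + tθ) coming from |θ| ≤ 2C. Its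
  -- maximum T²/(32 C²) is then at most 0, so T = 0; the sign of t follows that of T.
  set t : ℝ := T / (16 * C ^ 2) with ht
  have ht' : |t| * (2 * C) ≤ 1 / 2 := by
    rw [ht, abs_div, abs_of_pos (show 0 < 16 * C ^ 2 by positivity), div_mul_eq_mul_div,
      div_le_iff₀ (by positivity)]
    nlinarith
  have hb := 𝓜.half_le_one_add_mul_increment hC ht'
  have hlogi : Integrable (fun σ => Real.log (1 + t * θ σ)) Λ :=
    Integrable.of_bound (Real.measurable_log.comp_aemeasurable
      ((hθm.const_mul t).const_add 1)).aestronglyMeasurable 1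
      (ae_of_all _ fun σ => abs_log_le_one (hb _ _).1 (hb _ _).2)
  have hle : ∫ σ, Real.log (1 + t * θ σ) ∂Λ ≤ 0 := by
    have h1 := hfree.trans (add_le_add (ksEntropy_le_integral_tilt h_contr hδ h_pos h_open h_unif
      hx hS hΛ hf hC ht') le_rfl)
    rw [energyIntegral_energy hδ h_pos h_open h_unif hx hΛ, ← EReal.coe_add, ← EReal.coe_zero,
      EReal.coe_le_coe_iff] at h1
    linarith
  have hpt : ∀ σ, t * θ σ - 8 * C ^ 2 * t ^ 2 ≤ Real.log (1 + t * θ σ) := by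
    intro σ
    have h1 := (hb (σ 1) (𝓜.codingMap x σ)).1
    refine le_trans ?_ (sub_le_log_one_add (by linarith))
    have h2 : θ σ ^ 2 ≤ (2 * C) ^ 2 := sq_le_sq' (abs_le.1 (hθb σ)).1 (abs_le.1 (hθb σ)).2
    nlinarith [mul_le_mul_of_nonneg_left h2 (sq_nonneg t)]
  have h3 : t * T - 8 * C ^ 2 * t ^ 2 ≤ 0 := by
    refine le_trans (le_of_eq ?_) ((integral_mono ((hθi.const_mul t).sub (integrable_const _))
      hlogi hpt).trans hle)
    have h4 := integral_sub (hθi.const_mul t) (integrable_const (μ := Λ) (8 * C ^ 2 * t ^ 2))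
    rw [integral_const_mul] at h4
    simpa using h4.symm
  have h5 : t * T - 8 * C ^ 2 * t ^ 2 = T ^ 2 / (32 * C ^ 2) := by
    rw [ht]; field_simp; ring
  rw [h5] at h3
  have h6 : 0 ≤ T ^ 2 / (32 * C ^ 2) := by positivity
  have h7 : T ^ 2 / (32 * C ^ 2) = 0 := le_antisymm h3 h6
  rw [div_eq_zero_iff] at h7
  rcases h7 with h7 | h7
  · exact pow_eq_zero_iff two_ne_zero |>.1 h7
  · exact absurd h7 (by positivity)

end Equilibrium

/-! ### Invariance of the image measure -/

theorem isFiniteMeasure_adjointOp {V E K : Type*} [Fintype E] [MeasurableSpace K]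
    (𝓜 : MarkovSystem V E K) (ν : Measure K) [IsProbabilityMeasure ν] :
    IsFiniteMeasure (𝓜.adjointOp ν) := by
  refine ⟨?_⟩
  rw [adjointOp, Measure.coe_finsetSum, Finset.sum_apply, ENNReal.sum_lt_top]
  intro e _
  rw [Measure.map_apply (𝓜.w_measurable e) MeasurableSet.univ, preimage_univ,
    withDensity_apply _ MeasurableSet.univ, Measure.restrict_univ]
  calc ∫⁻ y, ENNReal.ofReal (𝓜.p e y) ∂ν ≤ ∫⁻ _, 1 ∂ν :=
        lintegral_mono fun y => by simpa using 𝓜.p_le_one e y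
    _ < ⊤ := by simp

end MarkovSystem

theorem proposition2
    {V E K : Type*} [Fintype V] [Fintype E] [MeasurableSpace E] [DiscreteMeasurableSpace E]
    [MetricSpace K] [ProperSpace K] [MeasurableSpace K] [BorelSpace K]
    (𝓜 : MarkovSystem V E K) (a : ℝ) (h_contr : 𝓜.IsContractive a)
    (h_open : ∀ v, IsOpen (𝓜.vertexSet v))
    (h_unif : ∀ e, UniformContinuousOn (𝓜.p e) (𝓜.vertexSet (𝓜.ini e)))
    (δ : ℝ) (hδ : 0 < δ) (h_pos : ∀ e, ∀ y ∈ 𝓜.vertexSet (𝓜.ini e), δ ≤ 𝓜.p e y)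
    (h_surj : Function.Surjective 𝓜.ini)
    (μ : Measure K) (h_prob : IsProbabilityMeasure μ) (h_inv : 𝓜.adjointOp μ = μ)
    (x : V → K) (hx : ∀ v, x v ∈ 𝓜.vertexSet v)
    (Λ : Measure (ℤ → E)) (hΛ : IsEquilibriumState (codeShift E) (𝓜.energy x) Λ) :
    (∀ᵐ σ ∂Λ, σ ∈ 𝓜.codingCore x) ∧
    AEMeasurable (𝓜.codingMap x) Λ ∧
    𝓜.adjointOp (Λ.map (𝓜.codingMap x)) = Λ.map (𝓜.codingMap x) := by
  obtain ⟨⟨hprob, hS⟩, heq⟩ := hΛ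
  have hfree : 0 ≤ ksEntropy (codeShift E) Λ + energyIntegral Λ (𝓜.energy x) := by
    rw [heq]
    exact MarkovSystem.pressure_energy_nonneg h_contr hδ h_pos h_open h_unif hx h_inv
  have hcore : ∀ᵐ σ ∂Λ, σ ∈ 𝓜.codingCore x := by
    -- In `EReal` a sum with ⊥ is ⊥ even if the entropy were ⊤, so non-negative free energy excludes
    -- energy -∞.
    refine MarkovSystem.ae_mem_codingCore_of_energyIntegral_ne_bot fun h => ?_
    rw [h, EReal.add_bot] at hfree
    exact absurd hfree (by simp)
  have hF := MarkovSystem.aemeasurable_codingMap hcore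
  refine ⟨hcore, hF, ?_⟩
  have : IsProbabilityMeasure (Λ.map (𝓜.codingMap x)) := Measure.isProbabilityMeasure_map hF
  have := 𝓜.isFiniteMeasure_adjointOp (Λ.map (𝓜.codingMap x))
  refine ext_of_forall_integral_eq_of_IsFiniteMeasure fun f => ?_
  have hfc : Continuous f := f.continuous
  -- The added 1 makes the bound strictly positive also for f = 0, since the choice of t divides by
  -- its square.
  have hfb : ∀ y, |f y| ≤ ‖f‖ + 1 := fun y => (f.norm_coe_le_norm y).trans (by linarith)
  have hUc := MarkovSystem.continuous_markovOp h_contr hδ h_pos h_open h_unif hfc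
  have hfm : AEStronglyMeasurable (fun σ => f (𝓜.codingMap x σ)) Λ :=
    (hfc.measurable.comp_aemeasurable hF).aestronglyMeasurable
  have hfi : Integrable (fun σ => f (𝓜.codingMap x σ)) Λ :=
    Integrable.of_bound hfm (‖f‖ + 1) (ae_of_all _ fun σ => hfb _)
  have hUi : Integrable (fun σ => 𝓜.markovOp f (𝓜.codingMap x σ)) Λ :=
    Integrable.of_bound (hUc.measurable.comp_aemeasurable hF).aestronglyMeasurable (‖f‖ + 1)
      (ae_of_all _ fun σ => 𝓜.abs_markovOp_le hfb _)
  rw [𝓜.integral_adjointOp _ f hfc.measurable (‖f‖ + 1) hfb,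
    integral_map hF hUc.aestronglyMeasurable, integral_map hF hfc.aestronglyMeasurable]
  have hshift : ∫ σ, f (𝓜.codingMap x (codeShift E σ)) ∂Λ = ∫ σ, f (𝓜.codingMap x σ) ∂Λ := by
    conv_rhs => rw [← hS.map_eq]
    rw [integral_map hS.measurable.aemeasurable (by rwa [hS.map_eq])]
  have hzero := MarkovSystem.integral_increment_eq_zero h_contr hδ h_pos h_open h_unif hx hS hcore
    hfree hfc (by positivity) hfb
  -- Equivariance of F identifies f(w_{σ_1} F(σ)) with f(F(Sσ)), so the vanishing mean increment
  -- compares f with Uf.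
  have hsub : ∫ σ, 𝓜.increment f (σ 1) (𝓜.codingMap x σ) ∂Λ =
      (∫ σ, f (𝓜.codingMap x (codeShift E σ)) ∂Λ) - ∫ σ, 𝓜.markovOp f (𝓜.codingMap x σ) ∂Λ := by
    have hSi : Integrable (fun σ => f (𝓜.codingMap x (codeShift E σ))) Λ :=
      hS.integrable_comp_of_integrable hfi
    rw [← integral_sub hSi hUi]
    refine integral_congr_ae ?_
    filter_upwards [hcore] with σ hσ
    rw [MarkovSystem.increment, MarkovSystem.codingMap_codeShift h_contr hδ h_pos h_open hx hσ]
  linarith
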